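/- **Setting.** Let $\mathcal U\subseteq\mathbb R^n$ be open, $f\in C^2(\mathcal U;\mathbb R^n)$, $g\in C^2(\mathcal U;\mathbb R)$, $L\in\mathbb R^{n\times1}$, $A(u)=Df(u)$, $B(u)=Dg(u)$, let $a_1(u)\le\dots\le a_n(u)$ be the (real) eigenvalues of $A(u)$, and fix $1\le p\le n$. Assume: * for every $u\in\mathcal U$ there is a symmetric positive definite $A_0$ such that $A_0A(u)$ is symmetric and $A_0LB(u)$ is symmetric, positive semidefinite of rank one; $a_p(u)$ is simple; no eigenvector of $A(u)$ lies in $\ker LB(u)$; $\nabla a_p(u)\cdot r_p(u)\ne0$ for every right eigenvector $r_p(u)\neq 0$ of $A(u)$ for $a_p(u)$; * $u_\pm\in\mathcal U$, $f(u_+)=f(u_-)$, $a_p(u_+)<0<a_{p+1}(u_+)$, $a_{p-1}(u_-)<0<a_p(u_-)$ (conditions on $a_0$ and $a_{n+1}$ being void), and $l_pLB(u)r_p>0$ at $u=u_\pm$ for left and right eigenvectors $l_p,r_p$ of $A(u)$ for $a_p(u)$ with $l_pr_p=1$; * $(U,Q)$, with $U\in C^1(\mathbb R;\mathcal U)$ and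 $Q\in C^2(\mathbb R)$, satisfies $f(U)'+LQ'=0$, $-Q''+Q+g(U)'=0$, $U\to u_\pm$ and $Q\to0$ as $x\to\pm\infty$, and $A(U(x))$ is singular exactly at $x=0$. Write $A(x)=A(U(x))$, $B(x)=B(U(x))$, $A_\pm=A(u_\pm)$, $B_\pm=B(u_\pm)$, $[u]=u_+-u_-$, $k=k_p=n-p+2$. Consider, for $W=(u,q,p)\in\mathbb C^{n+2}$, the spectral system $$(A(x)u)'=-(\lambda+LB(x))u+Lp,\qquad q'=B(x)u-p,\qquad p'=-q. \tag{1}$$ **Modes.** Fix $\delta>0$ and, for $|\lambda|<\delta$, solutions of (1) that are jointly continuous in $(x,\lambda)$ and analytic in $\lambda$, as follows. * $\phi_1^+,\dots,\phi_{k-1}^+$ are continuous solutions on all of $\mathbb R$ which, for some $\eta>0$, satisfy $\phi_j^+(x,\lambda)=e^{\mu_j^+(\lambda)x}\bigl(V_j^+(\lambda)+O(e^{-\eta|x|})\bigr)$ for $x\ge0$, uniformly in $\lambda$. Here $\mu_j^+$ and $V_j^+\ne0$ are analytic, and $e^{\mu_j^+x}V_j^+$ solves the system (1) with $A,B$ replaced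 by $A_+,B_+$. Moreover $\operatorname{Re}\mu^+_j(\lambda)<0$ for $\operatorname{Re}\lambda>0$, $\operatorname{Re}\mu_1^+(0)<0$ (fast mode), $\mu_j^+(0)=0$ for $2\le j\le k-1$ (slow modes), and the $V_j^+(0)$ are linearly independent. * $\phi_{k+1}^-,\dots,\phi_{n+2}^-$ are the analogous modes at $-\infty$: the same holds for $x\le0$ with $A_-,B_-$, with $\operatorname{Re}\mu^-_j(\lambda)>0$ for $\operatorname{Re}\lambda>0$, $\operatorname{Re}\mu_{n+2}^-(0)>0$, $\mu_j^-(0)=0$ for $k+1\le j\le n+1$. * At $\lambda=0$ the fast modes are normalized by $\phi_1^+(x,0)=\phi_{n+2}^-(x,0)=(U',Q',-Q)(x)$. * $W_k^+$ is a nontrivial (for every $\lambda$) solution on $x<0$ with $W_k^+\to0$ as $x\to0^-$, and $W_k^-$ is a nontrivial solution on $x>0$ with $W_k^-\to0$ as $x\to0^+$. With $\Phi^+=(\phi_1^+,\dots,\phi_{k-1}^+)$ and $\Phi^-=(\phi_{k+1}^-,\dots,\phi_{n+2}^-)$ put $$D_\pm(y,\lambda)=\det\bigl(\Phi^+\;\;W_k^\mp\;\;\Phi^-\bigr)(y,\lambda),\quad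 y\gtrless0,\qquad D_\pm(\lambda)=D_\pm(\pm1,\lambda).$$ Denote by $u_j^\pm,q_j^\pm,p_j^\pm$ the components of $\phi_j^\pm$ and by $u_k^\pm,q_k^\pm,p_k^\pm$ those of $W_k^\pm$. Let $r_j^+=A_+u_j^+(+\infty,0)$ for $2\le j\le k-1$ and $r_j^-=A_-u_j^-(-\infty,0)$ for $k+1\le j\le n+1$, where $u_j^\pm(\pm\infty,0)$ is the $u$-component of $V_j^\pm(0)$. Let $$\Delta=\det\bigl(r_2^+,\dots,r_{k-1}^+,r_{k+1}^-,\dots,r_{n+1}^-,-[u]\bigr),\qquad \gamma_\pm(y)=\det\begin{pmatrix}q_1^+&q_k^\mp\\p_1^+&p_k^\mp\end{pmatrix}(y,0).$$ **Claim.** 1. The $r_j^+$ are eigenvectors of $A_+$ for positive eigenvalues and span the sum of all eigenspaces of $A_+$ for positive eigenvalues; the $r_j^-$ are eigenvectors of $A_-$ for negative eigenvalues and span the sum of all eigenspaces of $A_-$ for negative eigenvalues. 2. For $\lambda$ sufficiently small, and locally uniformly in $y$ with $y\gtrless0$, respectively, $$D_\pm(y,\lambda)=(-1)^{n-p}(\det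 A(y))^{-1}\gamma_\pm(y)\,\Delta\,\lambda+O(|\lambda|^2).$$ 3. There is a constant $m\ne0$ with $D_+(\lambda)=m\,D_-(\lambda)+O(|\lambda|^2)$ as $\lambda\to0$. -/

import Mathlib

open Filter Topology Matrix

/-- The Jacobian matrix `Df(u)`. -/
noncomputable def jac {n : ℕ} (f : (Fin n → ℝ) → Fin n → ℝ) (u : Fin n → ℝ) :
    Matrix (Fin n) (Fin n) ℝ :=
  Matrix.of fun i j => fderiv ℝ f u (Pi.single j 1) i

/-- The row vector `Dg(u)`. -/
noncomputable def grad {n : ℕ} (g : (Fin n → ℝ) → ℝ) (u : Fin n → ℝ) : Fin n → ℝ :=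
  fun j => fderiv ℝ g u (Pi.single j 1)

/-- A stationary radiative Lax `p`-shock profile `(U, Q)` of the hyperbolic-elliptic system
`u_t + f(u)_x + L q_x = 0`, `-q_xx + q + g(u)_x = 0`, together with the structural hypotheses on
the system and on the shock. The principal index `p : Fin n` is counted from zero. -/
structure RadiativeShock (n : ℕ) where
  /-- the state space -/
  𝒰 : Set (Fin n → ℝ)
  f : (Fin n → ℝ) → Fin n → ℝ
  g : (Fin n → ℝ) → ℝ
  L : Fin n → ℝ
  /-- the principal index -/
  p : Fin n
  /-- the eigenvalues of `Df(u)` -/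
  a : Fin n → (Fin n → ℝ) → ℝ
  /-- the end state at `+∞` -/
  uR : Fin n → ℝ
  /-- the end state at `-∞` -/
  uL : Fin n → ℝ
  U : ℝ → Fin n → ℝ
  Q : ℝ → ℝ
  isOpen_𝒰 : IsOpen 𝒰
  /- regularity of the fluxes -/
  f_contDiff : ContDiffOn ℝ 2 f 𝒰
  g_contDiff : ContDiffOn ℝ 2 g 𝒰
  /- `a₁(u) ≤ ... ≤ aₙ(u)` are the eigenvalues of `A(u) = Df(u)`, with multiplicity -/
  a_mono : ∀ u ∈ 𝒰, Monotone fun j => a j u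
  a_charpoly : ∀ u ∈ 𝒰,
    (jac f u).charpoly = ∏ j, (Polynomial.X - Polynomial.C (a j u))
  /- symmetric dissipativity -/
  symm_dissip : ∀ u ∈ 𝒰, ∃ A₀ : Matrix (Fin n) (Fin n) ℝ, A₀.PosDef ∧
    (A₀ * jac f u).IsSymm ∧ (A₀ * vecMulVec L (grad g u)).PosSemidef ∧
    (A₀ * vecMulVec L (grad g u)).rank = 1
  /- the principal eigenvalue is simple -/
  simple : ∀ u ∈ 𝒰, ∀ j, j ≠ p → a j u ≠ a p u
  /- genuine coupling: no eigenvector of `A` lies in the kernel of `LB` -/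
  coupling : ∀ u ∈ 𝒰, ∀ (c : ℝ) (r : Fin n → ℝ), r ≠ 0 → jac f u *ᵥ r = c • r →
    vecMulVec L (grad g u) *ᵥ r ≠ 0
  uR_mem : uR ∈ 𝒰
  uL_mem : uL ∈ 𝒰
  /- Rankine-Hugoniot condition for a stationary shock -/
  rankineHugoniot : f uR = f uL
  /- Lax entropy conditions -/
  lax_R : a p uR < 0 ∧ ∀ j, p < j → 0 < a j uR
  lax_L : (∀ j, j < p → a j uL < 0) ∧ 0 < a p uL
  /- genuine nonlinearity of the principal field -/
  genuine : ∀ u ∈ 𝒰, ∀ r : Fin n → ℝ, r ≠ 0 → jac f u *ᵥ r = a p u • r →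
    fderiv ℝ (a p) u r ≠ 0
  /- positive diffusion at the end states -/
  diffusion : ∀ u, u = uR ∨ u = uL → ∀ l r : Fin n → ℝ, l ᵥ* jac f u = a p u • l →
    jac f u *ᵥ r = a p u • r → l ⬝ᵥ r = 1 → 0 < l ⬝ᵥ (vecMulVec L (grad g u) *ᵥ r)
  /- the profile -/
  U_mem : ∀ x, U x ∈ 𝒰
  U_contDiff : ContDiff ℝ 1 U
  Q_contDiff : ContDiff ℝ 2 Q
  profile_u : ∀ x, deriv (fun t => f (U t)) x + deriv Q x • L = 0
  profile_q : ∀ x, -deriv (deriv Q) x + Q x + deriv (fun t => g (U t)) x = 0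
  U_atTop : Tendsto U atTop (𝓝 uR)
  U_atBot : Tendsto U atBot (𝓝 uL)
  Q_atTop : Tendsto Q atTop (𝓝 0)
  Q_atBot : Tendsto Q atBot (𝓝 0)
  /- `x = 0` is the only point where `A(U(x))` is singular -/
  sonic : ∀ x, (jac f (U x)).det = 0 ↔ x = 0

/-- Phase space of the spectral problem: `W = (u, q, p)` with `u ∈ ℂⁿ`, `q, p ∈ ℂ`. -/
abbrev Phase (n : ℕ) := Fin (n + 2) → ℂ

namespace Phase

variable {n : ℕ}

def mk (u : Fin n → ℂ) (q p : ℂ) : Phase n := Fin.append u ![q, p]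

def u (W : Phase n) : Fin n → ℂ := fun i => W (Fin.castAdd 2 i)

def q (W : Phase n) : ℂ := W (Fin.natAdd n 0)

def p (W : Phase n) : ℂ := W (Fin.natAdd n 1)

end Phase

/-- `Θ W = (A u, q, p)`. -/
noncomputable def theta {n : ℕ} (A : Matrix (Fin n) (Fin n) ℝ) (W : Phase n) : Phase n :=
  Phase.mk (A.map Complex.ofReal *ᵥ W.u) W.q W.p

/-- The right-hand side `(-(z + LB) u + L p, B u - p, -q)` of the spectral system, where `z` is
the spectral parameter. -/
noncomputable def specRhs {n : ℕ} (L B : Fin n → ℝ) (z : ℂ) (W : Phase n) : Phase n :=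
  Phase.mk
    (-(z • W.u + (vecMulVec L B).map Complex.ofReal *ᵥ W.u) + W.p • fun i => (L i : ℂ))
    ((fun i => (B i : ℂ)) ⬝ᵥ W.u - W.p)
    (-W.q)

namespace RadiativeShock

variable {n : ℕ} (S : RadiativeShock n)

/-- `A(x) = Df(U(x))`. -/
noncomputable def A (x : ℝ) : Matrix (Fin n) (Fin n) ℝ := jac S.f (S.U x)

/-- `B(x) = Dg(U(x))`. -/
noncomputable def B (x : ℝ) : Fin n → ℝ := grad S.g (S.U x)

/-- `W` is a continuous solution on the open set `I` of the spectral system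
`(A u)' = -(z + LB) u + L p`, `q' = B u - p`, `p' = -q`. -/
def IsSol (z : ℂ) (I : Set ℝ) (W : ℝ → Phase n) : Prop :=
  ContinuousOn W I ∧
    ∀ x ∈ I, HasDerivAt (fun t => theta (S.A t) (W t)) (specRhs S.L (S.B x) z (W x)) x

/-- The derivative `(U', Q', P')` of the profile, where `P = g(U) - Q'`, so that `P' = -Q`. -/
noncomputable def profileDeriv (x : ℝ) : Phase n :=
  Phase.mk (fun i => ((deriv S.U x i : ℝ) : ℂ)) ((deriv S.Q x : ℝ) : ℂ) (-(S.Q x : ℂ))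

/-- The position `n - p + 2` (with `p` counted from one) of the column `W_{k_p}`, counted from
zero. -/
def kp : ℕ := n - S.p.val

/-- A decaying mode at `+∞` (for `σ = 1`) or at `-∞` (for `σ = -1`), where the end state is `e`.
It is a solution on the whole line, analytic in the spectral parameter `z` for `|z| < δ`, and
`φ(x, z) = e^{μ(z) x} (V(z) + O(e^{-η|x|}))` on the half line towards `σ∞`, uniformly in `z`,
where `μ(z), V(z)` are an analytic eigenvalue and eigenvector of the limiting
constant coefficient system. -/
structure IsDecayingMode (σ : ℝ) (e : Fin n → ℝ) (δ : ℝ) (φ : ℝ → ℂ → Phase n)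
    (μ : ℂ → ℂ) (V : ℂ → Phase n) : Prop where
  sol : ∀ z ∈ Metric.ball (0 : ℂ) δ, S.IsSol z Set.univ fun x => φ x z
  cont : ContinuousOn (fun w : ℝ × ℂ => φ w.1 w.2) (Set.univ ×ˢ Metric.ball (0 : ℂ) δ)
  holo : ∀ x, DifferentiableOn ℂ (φ x) (Metric.ball 0 δ)
  μ_holo : DifferentiableOn ℂ μ (Metric.ball 0 δ)
  V_holo : DifferentiableOn ℂ V (Metric.ball 0 δ)
  V_ne : ∀ z ∈ Metric.ball (0 : ℂ) δ, V z ≠ 0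
  eigen : ∀ z ∈ Metric.ball (0 : ℂ) δ,
    specRhs S.L (grad S.g e) z (V z) = μ z • theta (jac S.f e) (V z)
  /- decay at `σ∞` for `Re z > 0` -/
  decay : ∀ z ∈ Metric.ball (0 : ℂ) δ, 0 < z.re → σ * (μ z).re < 0
  asymp : ∃ C η : ℝ, 0 < η ∧ ∀ z ∈ Metric.ball (0 : ℂ) δ, ∀ x : ℝ, 0 ≤ σ * x →
    ‖φ x z - Complex.exp (μ z * x) • V z‖ ≤
      C * ‖Complex.exp (μ z * x)‖ * Real.exp (-η * |x|)

/-- The mode on the open half line `I` (with end point `0`) that decays to zero at the singular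
point `x = 0`. -/
structure IsSingularMode (I : Set ℝ) (δ : ℝ) (w : ℝ → ℂ → Phase n) : Prop where
  sol : ∀ z ∈ Metric.ball (0 : ℂ) δ, S.IsSol z I fun x => w x z
  cont : ContinuousOn (fun y : ℝ × ℂ => w y.1 y.2) (I ×ˢ Metric.ball (0 : ℂ) δ)
  holo : ∀ x ∈ I, DifferentiableOn ℂ (w x) (Metric.ball 0 δ)
  ne_zero : ∀ z ∈ Metric.ball (0 : ℂ) δ, ∃ x ∈ I, w x z ≠ 0
  tendsto_zero : ∀ z ∈ Metric.ball (0 : ℂ) δ, Tendsto (fun x => w x z) (𝓝[I] 0) (𝓝 0)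

/-- A choice of the modes that enter the Evans functions. With columns counted from zero, `φR c`
(modes decaying at `+∞`) is used for `c < kp`, with `c = 0` the fast mode, and `φL c` (modes
decaying at `-∞`) for `kp < c`, with `c = n + 1` the fast mode; other indices are unused. -/
structure EvansModes where
  δ : ℝ
  δ_pos : 0 < δ
  φR : Fin (n + 2) → ℝ → ℂ → Phase n
  μR : Fin (n + 2) → ℂ → ℂ
  VR : Fin (n + 2) → ℂ → Phase n
  φL : Fin (n + 2) → ℝ → ℂ → Phase n
  μL : Fin (n + 2) → ℂ → ℂ
  VL : Fin (n + 2) → ℂ → Phase n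
  /-- the mode on `x > 0` decaying to zero at `0⁺` -/
  wPos : ℝ → ℂ → Phase n
  /-- the mode on `x < 0` decaying to zero at `0⁻` -/
  wNeg : ℝ → ℂ → Phase n
  modeR : ∀ c : Fin (n + 2), c.val < S.kp →
    S.IsDecayingMode 1 S.uR δ (φR c) (μR c) (VR c)
  modeL : ∀ c : Fin (n + 2), S.kp < c.val →
    S.IsDecayingMode (-1) S.uL δ (φL c) (μL c) (VL c)
  fastR : (μR 0 0).re < 0
  slowR : ∀ c : Fin (n + 2), 1 ≤ c.val → c.val < S.kp → μR c 0 = 0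
  fastL : 0 < (μL (Fin.last (n + 1)) 0).re
  slowL : ∀ c : Fin (n + 2), S.kp < c.val → c.val < n + 1 → μL c 0 = 0
  indepR : LinearIndependent ℂ fun c : {c : Fin (n + 2) // c.val < S.kp} => VR c 0
  indepL : LinearIndependent ℂ fun c : {c : Fin (n + 2) // S.kp < c.val} => VL c 0
  /- at `z = 0` both fast modes are the derivative of the profile -/
  normR : ∀ x, φR 0 x 0 = S.profileDeriv x
  normL : ∀ x, φL (Fin.last (n + 1)) x 0 = S.profileDeriv x
  modePos : S.IsSingularMode (Set.Ioi 0) δ wPos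
  modeNeg : S.IsSingularMode (Set.Iio 0) δ wNeg

namespace EvansModes

variable {S} (M : S.EvansModes)

/-- `det (Φ⁺ w Φ⁻)(y, z)`. -/
noncomputable def evansDet (w : ℝ → ℂ → Phase n) (y : ℝ) (z : ℂ) : ℂ :=
  Matrix.det (Matrix.of fun i c : Fin (n + 2) =>
    (if c.val < S.kp then M.φR c y z else if c.val = S.kp then w y z else M.φL c y z) i)

/-- The Evans function `D₊(y, z)`, for `y > 0`. -/
noncomputable def DPos (y : ℝ) (z : ℂ) : ℂ := M.evansDet M.wPos y z

/-- The Evans function `D₋(y, z)`, for `y < 0`. -/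
noncomputable def DNeg (y : ℝ) (z : ℂ) : ℂ := M.evansDet M.wNeg y z

/-- `r_j⁺ = A₊ u_j⁺(+∞)`, at `z = 0`. -/
noncomputable def rR (c : Fin (n + 2)) : Fin n → ℂ :=
  (jac S.f S.uR).map Complex.ofReal *ᵥ (M.VR c 0).u

/-- `r_j⁻ = A₋ u_j⁻(-∞)`, at `z = 0`. -/
noncomputable def rL (c : Fin (n + 2)) : Fin n → ℂ :=
  (jac S.f S.uL).map Complex.ofReal *ᵥ (M.VL c 0).u

/-- The Lopatinski determinant `Δ = det (r₂⁺ ⋯ r⁺_{k-1}, r⁻_{k+1} ⋯ r⁻_{n+1}, -[u])`, where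
`k = n - p + 2` and `[u] = u₊ - u₋`. -/
noncomputable def lopatinski : ℂ :=
  Matrix.det (Matrix.of fun i c : Fin n =>
    if c.val + 1 < S.kp then M.rR c.castSucc.succ i
    else if c.val + 1 < n then M.rL c.succ.succ i
    else -((S.uR i - S.uL i : ℝ) : ℂ))

/-- The `2 × 2` determinant of the `(q, p)` components of the fast mode `φ₁⁺` and of `w`,
at `z = 0`. -/
noncomputable def gammaDet (w : ℝ → ℂ → Phase n) (y : ℝ) : ℂ :=
  !![(M.φR 0 y 0).q, (w y 0).q; (M.φR 0 y 0).p, (w y 0).p].det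

noncomputable def gammaPos (y : ℝ) : ℂ := M.gammaDet M.wPos y

noncomputable def gammaNeg (y : ℝ) : ℂ := M.gammaDet M.wNeg y

end EvansModes

end RadiativeShock

/-!
The argument rests on the conservation law `(A u + q L)' = -z u` (`IsSol.hasDerivAt_consFlux`). A row
operation replaces the rows `A u` of `det A(y) · D(y, z)` by the flux `A u + q L`
(`det_consFlux_cols`). At `z = 0` the flux of every column is constant in `y`: it is the vector `r_c`
for a slow mode, by the limit at infinity, and it vanishes for the derivative of the profile and for
the singular mode, by the limit at the sonic point.

The two fast modes coincide at `z = 0`, so that after subtracting one from the other the last column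
is `O(z)`, and `∂_z D(y, 0)` is the determinant with this column replaced by its derivative
(`Matrix.hasDerivAt_det_of_col_eq_zero`). The flux part of that derivative is `-[u]`: the flux of a
fast mode is `z` times an integral of `u` over a half line, and `u = U'` at `z = 0`
(`IsDecayingMode.hasDerivAt_consFlux_fast`). The columns of the fast and of the singular mode then
have only their `q` and `p` entries, and the determinant splits into `γ` and `Δ`
(`Matrix.det_eq_of_two_cols`). As `D` is jointly continuous and analytic in `z`, the Schwarz lemma
makes the remainder `O(z²)` locally uniformly in `y` (`exists_forall_norm_sub_mul_le_sq`).

The two coefficients are `(-1)^(n-p) Δ` times `γ₊ / det A` and `γ₋ / det A`, so `D₊` and `D₋` are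
comparable because `γ₊` and `γ₋` do not vanish (`EvansModes.gammaDet_ne_zero`). If one of them did, the
derivative of the profile would be a multiple of a singular mode, which gives `Q(0) = 0`. But
`Q'' = Q` at the critical points of `Q` off the sonic point, so the maximum principle would give
`Q = 0` and a constant profile (`Q_zero_ne_zero`).

The `u`-component of a slow mode at infinity is an eigenvector of `A` for `-1 / μ'(0)`, as the
eigenvalue equation divided by `z` shows in the limit; the sign of this eigenvalue is given by the
decay for `Re z > 0` (`IsDecayingMode.exists_eigenvalue`), and counting dimensions yields the spans.
-/

/-! ### Expansion of analytic functions, locally uniformly in a parameter -/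

/-- By the Schwarz lemma, the second order remainder at `0` of an analytic function is controlled
by a bound for the function. Hence a family `F y` that is jointly continuous, analytic in `z` and
vanishes at `z = 0` has a first order expansion that is uniform for `y` in a compact set, whatever
the regularity of its first order coefficient `c y` in `y`. -/
theorem exists_forall_norm_sub_mul_le_sq {F : ℝ → ℂ → ℂ} {c : ℝ → ℂ} {K : Set ℝ} {δ ε : ℝ}
    (hε : 0 < ε) (hεδ : 2 * ε < δ) (hK : IsCompact K)
    (hcont : ContinuousOn (fun w : ℝ × ℂ => F w.1 w.2) (K ×ˢ Metric.ball (0 : ℂ) δ))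
    (hF : ∀ y ∈ K, DifferentiableOn ℂ (F y) (Metric.ball 0 δ))
    (h0 : ∀ y ∈ K, F y 0 = 0) (hc : ∀ y ∈ K, HasDerivAt (F y) (c y) 0) :
    ∃ C : ℝ, ∀ y ∈ K, ∀ z : ℂ, ‖z‖ ≤ ε → ‖F y z - c y * z‖ ≤ C * ‖z‖ ^ 2 := by
  have hsub : Metric.closedBall (0 : ℂ) (2 * ε) ⊆ Metric.ball 0 δ :=
    Metric.closedBall_subset_ball hεδ
  obtain ⟨B, hB⟩ := (hK.prod (isCompact_closedBall (0 : ℂ) (2 * ε))).exists_bound_of_continuousOn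
    (hcont.mono (Set.prod_mono le_rfl hsub))
  refine ⟨2 * B / (2 * ε) ^ 2, fun y hy z hz => ?_⟩
  have hbd : ∀ w ∈ Metric.ball (0 : ℂ) (2 * ε), ‖F y w‖ ≤ B := fun w hw =>
    hB (y, w) ⟨hy, Metric.ball_subset_closedBall hw⟩
  have hdiff : DifferentiableOn ℂ (F y) (Metric.ball 0 (2 * ε)) :=
    (hF y hy).mono (Metric.ball_subset_closedBall.trans hsub)
  have hcB : ‖c y‖ ≤ B / (2 * ε) := by
    rw [← (hc y hy).deriv]
    refine Complex.norm_deriv_le_div_of_mapsTo_ball hdiff (fun w hw => ?_) (by positivity)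
    simpa [h0 y hy] using hbd w hw
  have hmaps : Set.MapsTo (fun w => F y w - c y * w) (Metric.ball 0 (2 * ε))
      (Metric.closedBall ((fun w => F y w - c y * w) 0) (2 * B)) := by
    intro w hw
    have hw' : ‖w‖ ≤ 2 * ε := (mem_ball_zero_iff.mp hw).le
    have h1 : ‖c y * w‖ ≤ B := by
      rw [norm_mul]
      calc ‖c y‖ * ‖w‖ ≤ B / (2 * ε) * (2 * ε) := by gcongr; exact (norm_nonneg _).trans hcB
        _ = B := by field_simp
    have h2 := hbd w hw
    simp only [h0 y hy, mul_zero, sub_zero, mem_closedBall_zero_iff]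
    linarith [norm_sub_le (F y w) (c y * w)]
  have ho : (fun w => (F y w - c y * w) - (F y 0 - c y * 0)) =o[𝓝 0] fun w => ‖w - 0‖ ^ 1 := by
    have := (hasDerivAt_iff_isLittleO.mp (hc y hy)).norm_right
    simpa [h0 y hy, mul_comm] using this
  have key := Complex.dist_le_mul_div_pow_of_mapsTo_ball_of_isLittleO
    (hdiff.sub ((differentiableOn_const (c y)).mul differentiableOn_id)) hmaps ho
    (z := z) (by rw [mem_ball_zero_iff]; linarith)
  have : dist (F y z - c y * z) (F y 0 - c y * 0) ≤ 2 * B * (dist z 0 / (2 * ε)) ^ (1 + 1) := key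
  rw [h0 y hy, mul_zero, sub_zero, dist_zero_right, dist_zero_right] at this
  calc ‖F y z - c y * z‖ ≤ _ := this
    _ = _ := by ring

/-! ### Differentiation in the spectral parameter of an exponentially decaying solution -/

/-- Let `∂ₓ F(x, z) = -z v(x, z)` with `v` exponentially decaying and `F → 0` as `x → ∞`, locally
uniformly in `z`. Then `F(y, z) = z ∫_y^∞ v(x, z) dx`, and if `v(·, 0)` is the derivative of `V`,
with `V → e`, then `∂_z F(y, 0) = e - V(y)` by dominated convergence. -/
theorem hasDerivAt_param_of_hasDerivAt_of_decay {E : Type*} [NormedAddCommGroup E]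
    [NormedSpace ℂ E] [CompleteSpace E] {F v : ℝ → ℂ → E} {V : ℝ → E} {e : E}
    {r β C : ℝ} (hr : 0 < r) (hβ : 0 < β)
    (hF : ∀ z ∈ Metric.closedBall (0 : ℂ) r, ∀ x, HasDerivAt (fun t => F t z) (-z • v x z) x)
    (hv : ContinuousOn (fun w : ℝ × ℂ => v w.1 w.2) (Set.univ ×ˢ Metric.closedBall (0 : ℂ) r))
    (hbd : ∀ z ∈ Metric.closedBall (0 : ℂ) r, ∀ x, 0 ≤ x → ‖v x z‖ ≤ C * Real.exp (-β * x))
    (hlim : ∀ z ∈ Metric.closedBall (0 : ℂ) r, Tendsto (fun x => F x z) atTop (𝓝 0))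
    (hV : ∀ x, HasDerivAt V (v x 0) x) (hVe : Tendsto V atTop (𝓝 e)) (y : ℝ) :
    HasDerivAt (F y) (e - V y) 0 := by
  have h0mem : (0 : ℂ) ∈ Metric.closedBall (0 : ℂ) r := Metric.mem_closedBall_self hr.le
  -- one exponential bound on the whole half line `(y, ∞)`
  obtain ⟨C', hC'⟩ : ∃ C', ∀ z ∈ Metric.closedBall (0 : ℂ) r, ∀ x, y ≤ x →
      ‖v x z‖ ≤ C' * Real.exp (-β * x) := by
    obtain ⟨B, hB⟩ := ((isCompact_Icc (a := y) (b := 0)).prod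
      (isCompact_closedBall (0 : ℂ) r)).exists_bound_of_continuousOn
      (hv.mono (Set.prod_mono (Set.subset_univ _) le_rfl))
    refine ⟨max C (max B 0), fun z hz x hx => ?_⟩
    rcases le_total 0 x with h | h
    · refine (hbd z hz x h).trans ?_
      gcongr
      exact le_max_left _ _
    · calc ‖v x z‖ ≤ B := hB (x, z) ⟨⟨hx, h⟩, hz⟩
        _ ≤ max C (max B 0) * 1 := by
          rw [mul_one]; exact (le_max_left _ _).trans (le_max_right _ _)
        _ ≤ _ := by
          gcongr
          rw [Real.one_le_exp_iff]; nlinarith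
  have hvx : ∀ z ∈ Metric.closedBall (0 : ℂ) r, Continuous fun x => v x z := fun z hz =>
    hv.comp_continuous (by fun_prop) (f := fun x : ℝ => (x, z)) fun x => ⟨trivial, hz⟩
  have hbint : MeasureTheory.IntegrableOn (fun x => C' * Real.exp (-β * x)) (Set.Ioi y) :=
    (integrableOn_exp_mul_Ioi (neg_lt_zero.mpr hβ) y).const_mul C'
  have hbd' : ∀ z ∈ Metric.closedBall (0 : ℂ) r, ∀ᵐ x ∂MeasureTheory.volume.restrict (Set.Ioi y),
      ‖v x z‖ ≤ C' * Real.exp (-β * x) := fun z hz =>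
    (MeasureTheory.ae_restrict_mem measurableSet_Ioi).mono fun x hx => hC' z hz x (le_of_lt hx)
  have hint : ∀ z ∈ Metric.closedBall (0 : ℂ) r,
      MeasureTheory.IntegrableOn (fun x => v x z) (Set.Ioi y) := fun z hz =>
    MeasureTheory.Integrable.mono' hbint (hvx z hz).aestronglyMeasurable (hbd' z hz)
  have hFint : ∀ z ∈ Metric.closedBall (0 : ℂ) r, F y z = z • ∫ x in Set.Ioi y, v x z := by
    intro z hz
    have := MeasureTheory.integral_Ioi_of_hasDerivAt_of_tendsto' (a := y) (fun x _ => hF z hz x)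
      ((hint z hz).smul (-z)) (hlim z hz)
    rw [MeasureTheory.integral_smul, zero_sub, neg_smul, neg_inj] at this
    exact this.symm
  have hInt0 : ∫ x in Set.Ioi y, v x 0 = e - V y :=
    MeasureTheory.integral_Ioi_of_hasDerivAt_of_tendsto' (fun x _ => hV x) (hint 0 h0mem) hVe
  have hnear : Metric.closedBall (0 : ℂ) r ∈ 𝓝 0 := Metric.closedBall_mem_nhds _ hr
  have hcontI : ContinuousAt (fun z => ∫ x in Set.Ioi y, v x z) 0 := by
    refine MeasureTheory.continuousAt_of_dominated (bound := fun x => C' * Real.exp (-β * x))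
      ?_ ?_ hbint ?_
    · filter_upwards [hnear] with z hz using (hvx z hz).aestronglyMeasurable
    · filter_upwards [hnear] with z hz using hbd' z hz
    · refine Eventually.of_forall fun x => ?_
      have : ContinuousOn (fun z : ℂ => v x z) (Metric.closedBall 0 r) :=
        hv.comp (f := fun z : ℂ => (x, z)) (by fun_prop) fun z hz => ⟨trivial, hz⟩
      exact this.continuousAt hnear
  rw [hasDerivAt_iff_tendsto_slope, ← hInt0]
  refine (hcontI.tendsto.mono_left nhdsWithin_le_nhds).congr' ?_
  filter_upwards [self_mem_nhdsWithin, nhdsWithin_le_nhds hnear] with z hz0 hz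
  rw [slope_def_module, hFint z hz, hFint 0 h0mem, zero_smul, sub_zero, sub_zero, smul_smul,
    inv_mul_cancel₀ hz0, one_smul]

/-! ### Determinants -/

/-- The derivative of a determinant at a point where one column vanishes. -/
theorem Matrix.hasDerivAt_det_of_col_eq_zero {m : ℕ} {N : ℂ → Matrix (Fin m) (Fin m) ℂ}
    {j : Fin m} {d : Fin m → ℂ} (hN : ContinuousAt N 0) (h0 : ∀ i, N 0 i j = 0)
    (hd : ∀ i, HasDerivAt (fun z => N z i j) (d i) 0) :
    HasDerivAt (fun z => (N z).det) (((N 0).updateCol j d).det) 0 := by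
  have hdet0 : (N 0).det = 0 := Matrix.det_eq_zero_of_column_eq_zero j h0
  rw [hasDerivAt_iff_tendsto_slope]
  have hlim : Tendsto (fun z : ℂ => ((N z).updateCol j fun i => z⁻¹ * N z i j).det) (𝓝[≠] 0)
      (𝓝 (((N 0).updateCol j d).det)) := by
    refine (Continuous.matrix_det continuous_id).continuousAt.tendsto.comp ?_
    refine tendsto_pi_nhds.mpr fun i => tendsto_pi_nhds.mpr fun k => ?_
    change Tendsto (fun z : ℂ => (N z).updateCol j (fun i => z⁻¹ * N z i j) i k) _
      (𝓝 ((N 0).updateCol j d i k))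
    by_cases hk : k = j
    · subst hk
      simp only [Matrix.updateCol_self]
      refine (hasDerivAt_iff_tendsto_slope.mp (hd i)).congr fun z => ?_
      simp [slope_def_field, h0 i, div_eq_inv_mul]
    · simp only [Matrix.updateCol_ne hk]
      have h1 : ContinuousAt (fun z => N z i k) 0 :=
        continuousAt_pi.mp (continuousAt_pi.mp hN i) k
      exact h1.tendsto.mono_left nhdsWithin_le_nhds
  refine hlim.congr' ?_
  filter_upwards [self_mem_nhdsWithin] with z hz
  have : (fun i => z⁻¹ * N z i j) = z⁻¹ • fun i => N z i j := rfl
  rw [slope_def_field, hdet0, this, Matrix.det_updateCol_smul]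
  simp [Matrix.updateCol_eq_self, div_eq_inv_mul]

/-- A determinant of size `n + 2` whose first `n` rows vanish in the columns `0` and `k + 1` is, up
to the sign `(-1) ^ (k + 2)`, the product of the `n × n` minor of the first `n` rows and the remaining
columns and the `2 × 2` minor of the last two rows and the columns `0` and `k + 1`. -/
theorem Matrix.det_eq_of_two_cols {R : Type*} [CommRing R] {n : ℕ}
    (N : Matrix (Fin (n + 2)) (Fin (n + 2)) R) (k : Fin (n + 1))
    (h0 : ∀ i : Fin n, N (Fin.castAdd 2 i) 0 = 0)
    (hk : ∀ i : Fin n, N (Fin.castAdd 2 i) k.succ = 0) :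
    N.det = (-1) ^ (k.val + 2) *
      (Matrix.of fun i c : Fin n => N (Fin.castAdd 2 i) (k.succ.succAbove c.succ)).det *
      !![N (Fin.natAdd n 0) 0, N (Fin.natAdd n 0) k.succ;
        N (Fin.natAdd n 1) 0, N (Fin.natAdd n 1) k.succ].det := by
  obtain ⟨σ, hin, hq, hp, hsign⟩ : ∃ σ : Equiv.Perm (Fin (n + 2)),
      (∀ c : Fin n, σ (Fin.castAdd 2 c) = k.succ.succAbove c.succ) ∧
      σ (Fin.natAdd n 0) = k.succ ∧ σ (Fin.natAdd n 1) = 0 ∧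
      Equiv.Perm.sign σ = (-1) ^ (k.val + 1) := by
    -- `τ` moves column `k + 1` to the front, and `ρ ^ 2` then moves the first two columns to the
    -- end
    let τ : Equiv.Perm (Fin (n + 2)) := (Fin.cycleRange k.succ).symm
    let ρ : Equiv.Perm (Fin (n + 2)) := Fin.cycleRange (Fin.last (n + 1))
    have hρlast : ρ (Fin.last (n + 1)) = 0 := Fin.cycleRange_self _
    have hρ : ∀ j : Fin (n + 1), ρ j.castSucc = j.succ := fun j => by
      rw [← Fin.succAbove_last, Fin.cycleRange_succAbove]
    have hτ0 : τ 0 = k.succ := Fin.cycleRange_symm_zero _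
    have hτs : ∀ j : Fin (n + 1), τ j.succ = k.succ.succAbove j := Fin.cycleRange_symm_succ _
    refine ⟨τ * ρ * ρ, fun c => ?_, ?_, ?_, ?_⟩
    · have h1 : Fin.castAdd 2 c = c.castSucc.castSucc := rfl
      rw [Equiv.Perm.mul_apply, Equiv.Perm.mul_apply, h1, hρ, Fin.succ_castSucc, hρ, hτs]
    · have h1 : (Fin.natAdd n 0 : Fin (n + 2)) = (Fin.last n).castSucc := rfl
      rw [Equiv.Perm.mul_apply, Equiv.Perm.mul_apply, h1, hρ, Fin.succ_last, hρlast, hτ0]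
    · have h1 : (Fin.natAdd n 1 : Fin (n + 2)) = Fin.last (n + 1) := rfl
      have h2 : ρ 0 = Fin.succ 0 := hρ 0
      rw [Equiv.Perm.mul_apply, Equiv.Perm.mul_apply, h1, hρlast, h2, hτs]
      rfl
    · rw [mul_assoc, Equiv.Perm.sign_mul, Equiv.Perm.sign_mul, Int.units_mul_self, mul_one,
        Equiv.Perm.sign_symm, Fin.sign_cycleRange, Fin.val_succ]
  have hperm : (N.submatrix id σ).det = (-1) ^ (k.val + 1) * N.det := by
    rw [Matrix.det_permute', hsign]; simp
  have hblock : (N.submatrix id σ).det =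
      (Matrix.of fun i c : Fin n => N (Fin.castAdd 2 i) (k.succ.succAbove c.succ)).det *
      !![N (Fin.natAdd n 0) k.succ, N (Fin.natAdd n 0) 0;
        N (Fin.natAdd n 1) k.succ, N (Fin.natAdd n 1) 0].det := by
    rw [← Matrix.det_submatrix_equiv_self finSumFinEquiv, ← Matrix.det_fromBlocks_zero₁₂ _
      (Matrix.of fun (i : Fin 2) (c : Fin n) => N (Fin.natAdd n i) (k.succ.succAbove c.succ))]
    congr 1
    ext i c
    rcases i with i | i <;> rcases c with c | c
    · simp [hin]
    · match c with
      | 0 => simpa [hq] using hk i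
      | 1 => simpa [hp] using h0 i
    · simp [hin]
    · match i, c with
      | 0, 0 | 0, 1 | 1, 0 | 1, 1 => simp [hq, hp]
  have hsq : ((-1 : R) ^ (k.val + 1)) * (-1) ^ (k.val + 1) = 1 := by
    rw [← mul_pow]; simp
  have hN : N.det = (-1) ^ (k.val + 1) * (N.submatrix id σ).det := by
    rw [hperm, ← mul_assoc, hsq, one_mul]
  rw [hN, hblock, Matrix.det_fin_two_of, Matrix.det_fin_two_of]
  ring

/-! ### The spectral system in conservative form -/

namespace Phase

variable {n : ℕ}

@[simp] theorem u_mk (v : Fin n → ℂ) (a b : ℂ) : (mk v a b).u = v := by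
  ext i; simp [mk, u]

@[simp] theorem q_mk (v : Fin n → ℂ) (a b : ℂ) : (mk v a b).q = a := by
  simp [mk, q]

@[simp] theorem p_mk (v : Fin n → ℂ) (a b : ℂ) : (mk v a b).p = b := by
  simp [mk, p]

theorem ext_components {W W' : Phase n} (hu : W.u = W'.u) (hq : W.q = W'.q) (hp : W.p = W'.p) :
    W = W' := by
  ext i
  induction i using Fin.addCases with
  | left i => exact congrFun hu i
  | right i =>
    match i with
    | 0 => exact hq
    | 1 => exact hp

theorem continuous_u : Continuous (u : Phase n → Fin n → ℂ) := by
  unfold u; fun_prop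

theorem continuous_p : Continuous (p : Phase n → ℂ) := by
  unfold p; fun_prop

theorem norm_u_le (W : Phase n) : ‖W.u‖ ≤ ‖W‖ :=
  (pi_norm_le_iff_of_nonneg (norm_nonneg _)).mpr fun _ => norm_le_pi_norm W _

@[simp] theorem u_zero : (0 : Phase n).u = 0 := rfl

@[simp] theorem q_zero : (0 : Phase n).q = 0 := rfl

@[simp] theorem p_zero : (0 : Phase n).p = 0 := rfl

end Phase

theorem map_ofReal_vecMulVec_mulVec {n : ℕ} (L B : Fin n → ℝ) (v : Fin n → ℂ) :
    (vecMulVec L B).map Complex.ofReal *ᵥ v =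
      ((fun i => (B i : ℂ)) ⬝ᵥ v) • fun i => (L i : ℂ) := by
  ext i
  simp only [mulVec, dotProduct, map_apply, vecMulVec_apply, Complex.ofReal_mul, Pi.smul_apply,
    smul_eq_mul, Finset.sum_mul]
  exact Finset.sum_congr rfl fun j _ => by ring

/-- The conserved quantity `A u + q L` of the phase vector `W = (u, q, p)`. -/
noncomputable def consFlux {n : ℕ} (A : Matrix (Fin n) (Fin n) ℝ) (L : Fin n → ℝ) (W : Phase n) :
    Fin n → ℂ :=
  A.map Complex.ofReal *ᵥ W.u + W.q • fun i => (L i : ℂ)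

theorem tendsto_consFlux {ι : Type*} {l : Filter ι} {n : ℕ} {A : ι → Matrix (Fin n) (Fin n) ℝ}
    {A₀ : Matrix (Fin n) (Fin n) ℝ} {W : ι → Phase n} {W₀ : Phase n} (hA : Tendsto A l (𝓝 A₀))
    (hW : Tendsto W l (𝓝 W₀)) (L : Fin n → ℝ) :
    Tendsto (fun t => consFlux (A t) L (W t)) l (𝓝 (consFlux A₀ L W₀)) := by
  refine tendsto_pi_nhds.mpr fun i => ?_
  refine (tendsto_finsetSum _ fun j _ => Tendsto.mul ?_ ?_).add (Tendsto.mul_const _ ?_)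
  · exact (Complex.continuous_ofReal.tendsto _).comp (hA.apply_nhds i |>.apply_nhds j)
  · exact hW.apply_nhds (Fin.castAdd 2 j)
  · exact hW.apply_nhds (Fin.natAdd n 0)

@[simp] theorem consFlux_zero {n : ℕ} (A : Matrix (Fin n) (Fin n) ℝ) (L : Fin n → ℝ) :
    consFlux A L 0 = 0 := by
  simp [consFlux]

theorem jac_mulVec {n : ℕ} (f : (Fin n → ℝ) → Fin n → ℝ) (u v : Fin n → ℝ) :
    jac f u *ᵥ v = fderiv ℝ f u v := by
  have h : jac f u = LinearMap.toMatrix' (fderiv ℝ f u : (Fin n → ℝ) →ₗ[ℝ] Fin n → ℝ) := by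
    ext i j; simp [jac, LinearMap.toMatrix'_apply]
  rw [h, LinearMap.toMatrix'_mulVec]; rfl

namespace RadiativeShock

variable {n : ℕ} (S : RadiativeShock n)

variable {S} in
theorem IsSol.hasDerivAt_q {z : ℂ} {I : Set ℝ} {W : ℝ → Phase n} (h : S.IsSol z I W) {x : ℝ}
    (hx : x ∈ I) :
    HasDerivAt (fun t => (W t).q) ((fun i => (S.B x i : ℂ)) ⬝ᵥ (W x).u - (W x).p) x := by
  have := hasDerivAt_pi.mp (h.2 x hx) (Fin.natAdd n 0)
  simpa [theta, specRhs, Phase.mk] using this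

variable {S} in
theorem IsSol.hasDerivAt_p {z : ℂ} {I : Set ℝ} {W : ℝ → Phase n} (h : S.IsSol z I W) {x : ℝ}
    (hx : x ∈ I) : HasDerivAt (fun t => (W t).p) (-(W x).q) x := by
  have := hasDerivAt_pi.mp (h.2 x hx) (Fin.natAdd n 1)
  simpa [theta, specRhs, Phase.mk] using this

variable {S} in
/-- Eliminating `LB u - L p = L q'` turns the first equation of the spectral system into the
conservation law `(A u + q L)' = -z u`. -/
theorem IsSol.hasDerivAt_consFlux {z : ℂ} {I : Set ℝ} {W : ℝ → Phase n} (h : S.IsSol z I W)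
    {x : ℝ} (hx : x ∈ I) :
    HasDerivAt (fun t => consFlux (S.A t) S.L (W t)) (-z • (W x).u) x := by
  have h1 : HasDerivAt (fun t => (S.A t).map Complex.ofReal *ᵥ (W t).u)
      (-(z • (W x).u + (vecMulVec S.L (S.B x)).map Complex.ofReal *ᵥ (W x).u) +
        (W x).p • fun i => (S.L i : ℂ)) x := by
    refine hasDerivAt_pi.mpr fun i => ?_
    have := hasDerivAt_pi.mp (h.2 x hx) (Fin.castAdd 2 i)
    simpa [theta, specRhs, Phase.mk] using this
  refine (h1.add ((h.hasDerivAt_q hx).smul_const fun i => (S.L i : ℂ))).congr_deriv ?_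
  rw [map_ofReal_vecMulVec_mulVec, sub_smul, neg_smul]
  abel

theorem continuousOn_jac : ContinuousOn (jac S.f) S.𝒰 := by
  have h := S.f_contDiff.continuousOn_fderiv_of_isOpen S.isOpen_𝒰 (by norm_num)
  refine continuousOn_pi.mpr fun i => continuousOn_pi.mpr fun j => ?_
  exact (continuous_apply i).comp_continuousOn (h.clm_apply continuousOn_const)

theorem continuousOn_grad : ContinuousOn (grad S.g) S.𝒰 := by
  have h := S.g_contDiff.continuousOn_fderiv_of_isOpen S.isOpen_𝒰 (by norm_num)
  exact continuousOn_pi.mpr fun j => h.clm_apply continuousOn_const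

theorem continuous_A : Continuous S.A :=
  S.continuousOn_jac.comp_continuous S.U_contDiff.continuous S.U_mem

theorem continuous_B : Continuous S.B :=
  S.continuousOn_grad.comp_continuous S.U_contDiff.continuous S.U_mem

theorem hasDerivAt_U (x : ℝ) : HasDerivAt S.U (deriv S.U x) x :=
  (S.U_contDiff.differentiable one_ne_zero x).hasDerivAt

theorem A_mulVec_deriv_U (x : ℝ) : S.A x *ᵥ deriv S.U x = -(deriv S.Q x • S.L) := by
  have h1 : HasFDerivAt S.f (fderiv ℝ S.f (S.U x)) (S.U x) :=
    ((S.f_contDiff.contDiffAt (S.isOpen_𝒰.mem_nhds (S.U_mem x))).differentiableAt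
      (by norm_num)).hasFDerivAt
  have h2 := (h1.comp_hasDerivAt x (S.hasDerivAt_U x)).deriv
  rw [A, jac_mulVec, ← h2, eq_neg_iff_add_eq_zero]
  exact S.profile_u x

theorem deriv_deriv_Q (x : ℝ) :
    deriv (deriv S.Q) x = S.Q x + fderiv ℝ S.g (S.U x) (deriv S.U x) := by
  have h1 : HasFDerivAt S.g (fderiv ℝ S.g (S.U x)) (S.U x) :=
    ((S.g_contDiff.contDiffAt (S.isOpen_𝒰.mem_nhds (S.U_mem x))).differentiableAt
      (by norm_num)).hasFDerivAt
  have h2 := (h1.comp_hasDerivAt x (S.hasDerivAt_U x)).deriv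
  have h3 := S.profile_q x
  have h4 : deriv (fun t => S.g (S.U t)) x = fderiv ℝ S.g (S.U x) (deriv S.U x) := h2
  linarith

theorem consFlux_profileDeriv (x : ℝ) : consFlux (S.A x) S.L (S.profileDeriv x) = 0 := by
  ext i
  have h := congrFun (S.A_mulVec_deriv_U x) i
  simp only [mulVec, dotProduct, Pi.neg_apply, Pi.smul_apply, smul_eq_mul] at h
  simp only [consFlux, profileDeriv, Phase.u_mk, Phase.q_mk, Pi.add_apply, mulVec, dotProduct,
    map_apply, Pi.smul_apply, smul_eq_mul, Pi.zero_apply]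
  rw [← eq_neg_iff_add_eq_zero]
  exact_mod_cast h

theorem det_A_ne_zero {x : ℝ} (hx : x ≠ 0) : (S.A x).det ≠ 0 := fun h =>
  hx ((S.sonic x).mp h)

theorem det_map_ofReal (A : Matrix (Fin n) (Fin n) ℝ) :
    (A.map Complex.ofReal).det = (A.det : ℂ) :=
  (RingHom.map_det Complex.ofRealHom A).symm

end RadiativeShock

/-! ### The profile at the sonic point -/

/-- Maximum principle for a function with `Q'' = Q` at its critical points other than `0`. -/
theorem nonpos_of_deriv_deriv_eq {Q : ℝ → ℝ} (hc : Continuous Q) (h0 : Q 0 ≤ 0)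
    (htop : Tendsto Q atTop (𝓝 0)) (hbot : Tendsto Q atBot (𝓝 0))
    (hcrit : ∀ x, x ≠ 0 → deriv Q x = 0 → deriv (deriv Q) x = Q x) (x : ℝ) : Q x ≤ 0 := by
  by_contra! hx
  have hev : ∀ᶠ t in cocompact ℝ, Q t ≤ Q x := by
    rw [cocompact_eq_atBot_atTop]
    exact eventually_sup.mpr ⟨hbot.eventually_le_const hx, htop.eventually_le_const hx⟩
  obtain ⟨m, hm⟩ := hc.exists_forall_ge' x hev
  have hm0 : 0 < Q m := hx.trans_le (hm x)
  have hmne : m ≠ 0 := by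
    rintro rfl; exact absurd hm0 (not_lt.mpr h0)
  have hmax : IsLocalMax Q m := Eventually.of_forall hm
  have hd : deriv Q m = 0 := hmax.deriv_eq_zero
  have hdd := hcrit m hmne hd
  have hmin : IsLocalMin Q m := isLocalMin_of_deriv_deriv_pos (hdd ▸ hm0) hd hc.continuousAt
  -- a local minimum that is a local maximum: `Q` is locally constant, so that `Q'' = 0`
  have hconst : Q =ᶠ[𝓝 m] fun _ => Q m := by
    filter_upwards [hmin, hmax] with t h1 h2 using le_antisymm h2 h1
  have : deriv (deriv Q) m = 0 := by
    rw [hconst.deriv.deriv_eq]; simp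
  linarith

namespace RadiativeShock

variable {n : ℕ} (S : RadiativeShock n)

theorem deriv_U_eq_zero {x : ℝ} (hx : x ≠ 0) (hQ : deriv S.Q x = 0) : deriv S.U x = 0 := by
  refine Matrix.eq_zero_of_mulVec_eq_zero (S.det_A_ne_zero hx) ?_
  rw [S.A_mulVec_deriv_U, hQ, zero_smul, neg_zero]

/-- If `Q` vanished at the sonic point, the maximum principle would give `Q = 0`, and the profile
would be constant. -/
theorem Q_zero_ne_zero : S.Q 0 ≠ 0 := by
  intro h0
  have hcrit : ∀ x, x ≠ 0 → deriv S.Q x = 0 → deriv (deriv S.Q) x = S.Q x := fun x hx hQ => by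
    rw [S.deriv_deriv_Q, S.deriv_U_eq_zero hx hQ, map_zero, add_zero]
  have hle := nonpos_of_deriv_deriv_eq S.Q_contDiff.continuous h0.le S.Q_atTop S.Q_atBot hcrit
  have hge := nonpos_of_deriv_deriv_eq (Q := fun x => -S.Q x) S.Q_contDiff.continuous.neg
    (by simp [h0]) (by simpa using S.Q_atTop.neg) (by simpa using S.Q_atBot.neg) fun x hx hQ => by
      have hd : deriv (fun x => -S.Q x) = fun x => -deriv S.Q x := funext fun x => deriv.fun_neg
      rw [hd] at hQ ⊢
      rw [deriv.fun_neg, hcrit x hx (neg_eq_zero.mp hQ)]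
  have hQ : S.Q = fun _ => 0 := funext fun x => le_antisymm (hle x) (neg_nonpos.mp (hge x))
  have hU : deriv S.U = fun _ => 0 := by
    refine Continuous.ext_on (dense_compl_singleton (0 : ℝ))
      (S.U_contDiff.continuous_deriv le_rfl) continuous_const fun x hx => ?_
    exact S.deriv_U_eq_zero hx (by rw [hQ]; simp)
  have hconst : ∀ x, S.U x = S.U 0 := fun x =>
    is_const_of_deriv_eq_zero (S.U_contDiff.differentiable one_ne_zero) (fun x => congrFun hU x) x 0
  have hUc : S.U = fun _ => S.U 0 := funext hconst
  have hR := S.U_atTop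
  have hL := S.U_atBot
  rw [hUc, tendsto_const_nhds_iff] at hR hL
  have h1 := S.lax_R.1
  have h2 := S.lax_L.2
  rw [← hR] at h1
  rw [← hL] at h2
  exact lt_asymm h1 h2

end RadiativeShock

/-! ### Solutions with vanishing flux, and `γ ≠ 0` -/

/-- Uniqueness for the planar system `q' = κ q - p`, `p' = -q`. -/
theorem eq_zero_of_planar_system {I : Set ℝ} (hI : I.OrdConnected) {κ q p : ℝ → ℂ}
    (hκ : ContinuousOn κ I) (hq : ∀ x ∈ I, HasDerivAt q (κ x * q x - p x) x)
    (hp : ∀ x ∈ I, HasDerivAt p (-q x) x) {y : ℝ} (hy : y ∈ I) (hqy : q y = 0) (hpy : p y = 0)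
    {x : ℝ} (hx : x ∈ I) : q x = 0 ∧ p x = 0 := by
  have hsub : Set.uIcc y x ⊆ I := hI.uIcc_subset hy hx
  -- `κ` may be unbounded on `I`, but it is bounded between `y` and `x`
  obtain ⟨B, hB⟩ := isCompact_uIcc.exists_bound_of_continuousOn (hκ.mono hsub)
  let v : ℝ → ℂ × ℂ → ℂ × ℂ := fun t w => (κ t * w.1 - w.2, -w.1)
  have hlip : ∀ t ∈ Set.uIcc y x, LipschitzOnWith (B.toNNReal + 1) (v t) Set.univ := by
    intro t ht
    refine LipschitzOnWith.of_dist_le_mul fun a _ b _ => ?_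
    have h1 : ‖(a - b).1‖ ≤ ‖a - b‖ := norm_fst_le _
    have h2 : ‖(a - b).2‖ ≤ ‖a - b‖ := norm_snd_le _
    have hB' : ‖κ t‖ ≤ (B.toNNReal : ℝ) := (hB t ht).trans (Real.le_coe_toNNReal B)
    have hv : v t a - v t b = (κ t * (a - b).1 - (a - b).2, -(a - b).1) := by
      ext <;> simp [v] <;> ring
    rw [dist_eq_norm, dist_eq_norm, hv, Prod.norm_mk, NNReal.coe_add, NNReal.coe_one]
    refine max_le ((norm_sub_le _ _).trans ?_) ?_
    · rw [norm_mul, add_mul, one_mul]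
      gcongr
    · rw [norm_neg]
      nlinarith [norm_nonneg (a - b), norm_nonneg (κ t)]
  let W : ℝ → ℂ × ℂ := fun t => (q t, p t)
  have hW : ∀ t ∈ I, HasDerivAt W (v t (W t)) t := fun t ht => (hq t ht).prodMk (hp t ht)
  have hv0 : ∀ t, v t 0 = 0 := fun t => by ext <;> simp [v]
  have h0 : ∀ t, HasDerivAt (fun _ : ℝ => (0 : ℂ × ℂ)) (v t 0) t := fun t => by
    rw [hv0]; exact hasDerivAt_const t (0 : ℂ × ℂ)
  have hWy : W y = 0 := Prod.ext hqy hpy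
  have hWc : ∀ {s : Set ℝ}, s ⊆ I → ContinuousOn W s := fun hs =>
    HasDerivAt.continuousOn fun t ht => hW t (hs ht)
  have hWx : W x = 0 := by
    rcases le_total y x with hyx | hxy
    · rw [Set.uIcc_of_le hyx] at hsub hlip
      exact ODE_solution_unique_of_mem_Icc_right (s := fun _ => Set.univ)
        (fun t ht => hlip t (Set.Ico_subset_Icc_self ht)) (hWc hsub)
        (fun t ht => (hW t (hsub (Set.Ico_subset_Icc_self ht))).hasDerivWithinAt)
        (fun _ _ => trivial) continuousOn_const (fun t _ => (h0 t).hasDerivWithinAt)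
        (fun _ _ => trivial) hWy (Set.right_mem_Icc.mpr hyx)
    · rw [Set.uIcc_of_ge hxy] at hsub hlip
      exact ODE_solution_unique_of_mem_Icc_left (s := fun _ => Set.univ)
        (fun t ht => hlip t (Set.Ioc_subset_Icc_self ht)) (hWc hsub)
        (fun t ht => (hW t (hsub (Set.Ioc_subset_Icc_self ht))).hasDerivWithinAt)
        (fun _ _ => trivial) continuousOn_const (fun t _ => (h0 t).hasDerivWithinAt)
        (fun _ _ => trivial) hWy (Set.left_mem_Icc.mpr hxy)
  exact ⟨congrArg Prod.fst hWx, congrArg Prod.snd hWx⟩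

namespace RadiativeShock

variable {n : ℕ} {S : RadiativeShock n}

/-- Away from the sonic point `A` is invertible, and a vanishing flux determines `u` from `q`. -/
theorem u_eq_of_consFlux_eq_zero {x : ℝ} (hx : x ≠ 0) {W : Phase n}
    (h : consFlux (S.A x) S.L W = 0) :
    W.u = -(W.q • ((S.A x).map Complex.ofReal)⁻¹ *ᵥ fun i => (S.L i : ℂ)) := by
  have hdet : IsUnit ((S.A x).map Complex.ofReal).det := by
    rw [det_map_ofReal]
    exact isUnit_iff_ne_zero.mpr (Complex.ofReal_ne_zero.mpr (S.det_A_ne_zero hx))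
  have h' := congrArg (fun v => ((S.A x).map Complex.ofReal)⁻¹ *ᵥ v) h
  simp only [consFlux, mulVec_add, mulVec_smul, mulVec_mulVec, nonsing_inv_mul _ hdet, one_mulVec,
    mulVec_zero] at h'
  exact eq_neg_of_add_eq_zero_left h'

/-- Away from the sonic point, a combination `α W + β W'` of solutions with vanishing flux is
determined by the values of `q` and `p` at one point, as these solve a regular planar system. -/
theorem IsSol.combination_eq_zero {I : Set ℝ} (hI : I.OrdConnected) (hI0 : 0 ∉ I)
    {W W' : ℝ → Phase n} (hW : S.IsSol 0 I W) (hW' : S.IsSol 0 I W')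
    (hf : ∀ x ∈ I, consFlux (S.A x) S.L (W x) = 0)
    (hf' : ∀ x ∈ I, consFlux (S.A x) S.L (W' x) = 0) {α β : ℂ} {y : ℝ} (hy : y ∈ I)
    (hqy : α * (W y).q + β * (W' y).q = 0) (hpy : α * (W y).p + β * (W' y).p = 0)
    {x : ℝ} (hx : x ∈ I) : α • W x + β • W' x = 0 := by
  have hne : ∀ {t}, t ∈ I → t ≠ 0 := fun ht h => hI0 (h ▸ ht)
  let ℓ : ℝ → Fin n → ℂ := fun t => ((S.A t).map Complex.ofReal)⁻¹ *ᵥ fun i => (S.L i : ℂ)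
  let κ : ℝ → ℂ := fun t => -((fun i => (S.B t i : ℂ)) ⬝ᵥ ℓ t)
  have hu : ∀ t ∈ I, (W t).u = -((W t).q • ℓ t) := fun t ht =>
    u_eq_of_consFlux_eq_zero (hne ht) (hf t ht)
  have hu' : ∀ t ∈ I, (W' t).u = -((W' t).q • ℓ t) := fun t ht =>
    u_eq_of_consFlux_eq_zero (hne ht) (hf' t ht)
  have hκ : ContinuousOn κ I := by
    have hA : Continuous fun t => (S.A t).map Complex.ofReal :=
      S.continuous_A.matrix_map Complex.continuous_ofReal
    have hinv : ContinuousOn (fun t => ((S.A t).map Complex.ofReal)⁻¹) I := by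
      simp only [Matrix.inv_def, Ring.inverse_eq_inv']
      refine ContinuousOn.smul (hA.matrix_det.continuousOn.inv₀ fun t ht => ?_)
        hA.matrix_adjugate.continuousOn
      rw [det_map_ofReal]
      exact Complex.ofReal_ne_zero.mpr (S.det_A_ne_zero (hne ht))
    have hB : Continuous fun t => fun i => (S.B t i : ℂ) :=
      continuous_pi fun i => Complex.continuous_ofReal.comp (continuous_pi_iff.mp S.continuous_B i)
    have hℓ : ContinuousOn ℓ I := by
      have : Continuous fun N : Matrix (Fin n) (Fin n) ℂ => N *ᵥ fun i => (S.L i : ℂ) :=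
        continuous_id.matrix_mulVec continuous_const
      exact this.comp_continuousOn hinv
    have hdot : Continuous fun w : (Fin n → ℂ) × (Fin n → ℂ) => w.1 ⬝ᵥ w.2 :=
      continuous_fst.dotProduct continuous_snd
    exact (hdot.comp_continuousOn (hB.continuousOn.prodMk hℓ)).neg
  have key := eq_zero_of_planar_system hI hκ
    (q := fun t => α * (W t).q + β * (W' t).q) (p := fun t => α * (W t).p + β * (W' t).p)
    (fun t ht => by
      refine (((hW.hasDerivAt_q ht).const_mul α).add
        ((hW'.hasDerivAt_q ht).const_mul β)).congr_deriv ?_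
      rw [hu t ht, hu' t ht]
      simp only [κ, dotProduct_neg, dotProduct_smul, smul_eq_mul]
      ring)
    (fun t ht => by
      refine (((hW.hasDerivAt_p ht).const_mul α).add
        ((hW'.hasDerivAt_p ht).const_mul β)).congr_deriv ?_
      ring) hy hqy hpy hx
  refine Phase.ext_components ?_ key.1 key.2
  change α • (W x).u + β • (W' x).u = 0
  rw [hu x hx, hu' x hx, smul_neg, smul_neg, smul_smul, smul_smul, ← neg_add, ← add_smul, key.1,
    zero_smul, neg_zero]

/-- At `z = 0` the flux of a singular mode is constant, and it vanishes at the sonic point. -/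
theorem IsSingularMode.consFlux_eq_zero {I : Set ℝ} (hIo : IsOpen I) (hI : I.OrdConnected)
    [NeBot (𝓝[I] (0 : ℝ))] {δ : ℝ} (hδ : 0 < δ) {w : ℝ → ℂ → Phase n}
    (hw : S.IsSingularMode I δ w) {x : ℝ} (hx : x ∈ I) : consFlux (S.A x) S.L (w x 0) = 0 := by
  have h0 : (0 : ℂ) ∈ Metric.ball (0 : ℂ) δ := Metric.mem_ball_self hδ
  have hd : ∀ t ∈ I, HasDerivAt (fun t => consFlux (S.A t) S.L (w t 0)) 0 t := fun t ht => by
    have := (hw.sol 0 h0).hasDerivAt_consFlux ht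
    rwa [neg_zero, zero_smul] at this
  have hconst : ∀ t ∈ I, consFlux (S.A t) S.L (w t 0) = consFlux (S.A x) S.L (w x 0) :=
    fun t ht => hIo.is_const_of_deriv_eq_zero hI.isPreconnected
      (fun s hs => (hd s hs).differentiableAt.differentiableWithinAt)
      (fun s hs => (hd s hs).deriv) ht hx
  have hlim : Tendsto (fun t => consFlux (S.A t) S.L (w t 0)) (𝓝[I] 0)
      (𝓝 (consFlux (S.A 0) S.L 0)) :=
    tendsto_consFlux (S.continuous_A.continuousAt.tendsto.mono_left nhdsWithin_le_nhds)
      (hw.tendsto_zero 0 h0) S.L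
  have heq : (fun t => consFlux (S.A t) S.L (w t 0)) =ᶠ[𝓝[I] 0]
      fun _ => consFlux (S.A x) S.L (w x 0) := by
    filter_upwards [self_mem_nhdsWithin] with t ht using hconst t ht
  rw [consFlux_zero, tendsto_congr' heq] at hlim
  exact tendsto_nhds_unique tendsto_const_nhds hlim

namespace EvansModes

variable (M : S.EvansModes)

theorem zero_mem_ball : (0 : ℂ) ∈ Metric.ball (0 : ℂ) M.δ := Metric.mem_ball_self M.δ_pos

theorem kp_pos : 0 < S.kp := by
  have := S.p.isLt
  unfold kp
  omega

theorem kp_le : S.kp ≤ n := Nat.sub_le _ _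

theorem fastMode : S.IsDecayingMode 1 S.uR M.δ (M.φR 0) (M.μR 0) (M.VR 0) :=
  M.modeR 0 kp_pos

theorem fastModeL : S.IsDecayingMode (-1) S.uL M.δ (M.φL (Fin.last (n + 1)))
    (M.μL (Fin.last (n + 1))) (M.VL (Fin.last (n + 1))) :=
  M.modeL _ (Nat.lt_succ_of_le kp_le)

/-- The determinant `γ` does not vanish: otherwise the derivative of the profile would be a multiple
of the singular mode, whence `Q(0) = 0`. -/
theorem gammaDet_ne_zero {I : Set ℝ} (hIo : IsOpen I) (hI : I.OrdConnected) (hI0 : 0 ∉ I)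
    [NeBot (𝓝[I] (0 : ℝ))] {w : ℝ → ℂ → Phase n} (hw : S.IsSingularMode I M.δ w) {y : ℝ}
    (hy : y ∈ I) : M.gammaDet w y ≠ 0 := by
  intro hγ
  obtain ⟨v, hv0, hv⟩ := Matrix.exists_mulVec_eq_zero_iff.mpr hγ
  have hq : v 0 * (M.φR 0 y 0).q + v 1 * (w y 0).q = 0 := by
    have := congrFun hv 0
    simpa [mulVec, dotProduct, Fin.sum_univ_two, mul_comm] using this
  have hp : v 0 * (M.φR 0 y 0).p + v 1 * (w y 0).p = 0 := by
    have := congrFun hv 1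
    simpa [mulVec, dotProduct, Fin.sum_univ_two, mul_comm] using this
  have hφ : S.IsSol 0 I fun x => M.φR 0 x 0 :=
    ⟨((M.fastMode.sol 0 M.zero_mem_ball).1).mono (Set.subset_univ I),
      fun x _ => (M.fastMode.sol 0 M.zero_mem_ball).2 x trivial⟩
  have hcomb : ∀ x ∈ I, v 0 • M.φR 0 x 0 + v 1 • w x 0 = 0 := fun x hx =>
    hφ.combination_eq_zero hI hI0 (hw.sol 0 M.zero_mem_ball)
      (fun x _ => by rw [M.normR]; exact S.consFlux_profileDeriv x)
      (fun x hx => hw.consFlux_eq_zero hIo hI M.δ_pos hx) hy hq hp hx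
  have hlim : Tendsto (fun x => v 0 • M.φR 0 x 0 + v 1 • w x 0) (𝓝[I] 0)
      (𝓝 (v 0 • M.φR 0 0 0 + v 1 • 0)) := by
    have hc : Continuous fun x => M.φR 0 x 0 :=
      continuousOn_univ.mp (M.fastMode.sol 0 M.zero_mem_ball).1
    exact ((hc.continuousAt.tendsto.mono_left nhdsWithin_le_nhds).const_smul (v 0)).add
      ((hw.tendsto_zero 0 M.zero_mem_ball).const_smul (v 1))
  have hzero : v 0 • M.φR 0 0 0 = 0 := by
    have := tendsto_nhds_unique (hlim.congr' (f₂ := fun _ => 0) (by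
      filter_upwards [self_mem_nhdsWithin] with x hx using hcomb x hx)) tendsto_const_nhds
    simpa using this
  rcases smul_eq_zero.mp hzero with h | h
  · have h1 : v 1 ≠ 0 := fun h1 => hv0 (by
      ext i
      match i with
      | 0 => exact h
      | 1 => exact h1)
    obtain ⟨x, hx, hwx⟩ := hw.ne_zero 0 M.zero_mem_ball
    have := hcomb x hx
    rw [h, zero_smul, zero_add] at this
    exact hwx ((smul_eq_zero.mp this).resolve_left h1)
  · have := congrArg Phase.p h
    rw [M.normR, profileDeriv, Phase.p_mk, Phase.p_zero, neg_eq_zero] at this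
    exact S.Q_zero_ne_zero (by exact_mod_cast this)

end EvansModes

end RadiativeShock

/-! ### Slow modes and the eigenvectors of the end states -/

/-- If there are as many independent eigenvectors with eigenvalues in `P` as there are eigenvalues
in `P`, counted with algebraic multiplicity, then they span the sum of the corresponding
eigenspaces. -/
theorem span_range_eq_iSup_eigenspace {n : ℕ} {ι : Type*} [Fintype ι]
    (A : Matrix (Fin n) (Fin n) ℝ) (a : Fin n → ℝ)
    (ha : A.charpoly = ∏ j, (Polynomial.X - Polynomial.C (a j))) (P : ℝ → Prop) [DecidablePred P]
    (v : ι → Fin n → ℂ) (hv : LinearIndependent ℂ v)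
    (hP : ∀ c, ∃ b : ℝ, P b ∧
      v c ∈ Module.End.eigenspace (Matrix.toLin' (A.map Complex.ofReal)) (b : ℂ))
    (hcard : Fintype.card ι = (Finset.univ.filter fun j => P (a j)).card) :
    Submodule.span ℂ (Set.range v) = ⨆ (b : ℝ) (_ : P b),
      Module.End.eigenspace (Matrix.toLin' (A.map Complex.ofReal)) (b : ℂ) := by
  classical
  set T : Module.End ℂ (Fin n → ℂ) := Matrix.toLin' (A.map Complex.ofReal) with hT
  have hchar : T.charpoly = ∏ j, (Polynomial.X - Polynomial.C ((a j : ℝ) : ℂ)) := by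
    have h1 : T.charpoly = (A.map Complex.ofReal).charpoly := by
      rw [hT, Matrix.charpoly_toLin']
    have h2 : (A.map Complex.ofReal).charpoly = A.charpoly.map Complex.ofRealHom :=
      Matrix.charpoly_map A Complex.ofRealHom
    rw [h1, h2, ha, Polynomial.map_prod]
    simp
  have hroots : T.charpoly.roots = Finset.univ.val.map fun j => ((a j : ℝ) : ℂ) := by
    have h1 := Polynomial.roots_multiset_prod_X_sub_C
      (Finset.univ.val.map fun j => ((a j : ℝ) : ℂ))
    rw [Multiset.map_map] at h1
    rw [hchar]
    exact h1
  have hmult : ∀ b : ℝ, T.charpoly.rootMultiplicity (b : ℂ) =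
      (Finset.univ.filter fun j => a j = b).card := by
    intro b
    rw [← Polynomial.count_roots, hroots, Multiset.count_map, ← Finset.filter_val]
    simp [Finset.card_def, eq_comm]
  have hle : Submodule.span ℂ (Set.range v) ≤ ⨆ (b : ℝ) (_ : P b), T.eigenspace (b : ℂ) := by
    rw [Submodule.span_le]
    rintro _ ⟨c, rfl⟩
    obtain ⟨b, hb, hm⟩ := hP c
    exact Submodule.mem_iSup_of_mem b (Submodule.mem_iSup_of_mem hb hm)
  refine Submodule.eq_of_le_of_finrank_le hle ?_
  rw [finrank_span_eq_card hv, hcard]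
  let s : Finset ℝ := (Finset.univ.filter fun j => P (a j)).image a
  -- only the eigenvalues among the `a j` contribute
  have hsup : (⨆ (b : ℝ) (_ : P b), T.eigenspace (b : ℂ)) ≤ s.sup fun b => T.eigenspace (b : ℂ) := by
    refine iSup₂_le fun b hb => ?_
    by_cases hbs : b ∈ s
    · exact Finset.le_sup (f := fun b : ℝ => T.eigenspace (b : ℂ)) hbs
    · have h0 : Module.finrank ℂ (T.eigenspace (b : ℂ)) = 0 := by
        refine Nat.eq_zero_of_le_zero ((T.finrank_eigenspace_le _).trans ?_)
        rw [hmult, Nat.le_zero, Finset.card_eq_zero, Finset.filter_eq_empty_iff]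
        rintro j - rfl
        exact hbs (Finset.mem_image_of_mem a (by simpa using hb))
      rw [Submodule.finrank_eq_zero.mp h0]
      exact bot_le
  have hsum : ∀ t : Finset ℝ, Module.finrank ℂ ↥(t.sup fun b => T.eigenspace (b : ℂ)) ≤
      ∑ b ∈ t, Module.finrank ℂ (T.eigenspace (b : ℂ)) := by
    intro t
    induction t using Finset.induction_on with
    | empty => simp
    | insert b t hb ih =>
      rw [Finset.sup_insert, Finset.sum_insert hb]
      exact (Submodule.finrank_add_le_finrank_add_finrank _ _).trans (Nat.add_le_add_left ih _)
  calc Module.finrank ℂ ↥(⨆ (b : ℝ) (_ : P b), T.eigenspace (b : ℂ))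
      ≤ Module.finrank ℂ ↥(s.sup fun b => T.eigenspace (b : ℂ)) := Submodule.finrank_mono hsup
    _ ≤ ∑ b ∈ s, Module.finrank ℂ (T.eigenspace (b : ℂ)) := hsum s
    _ ≤ ∑ b ∈ s, ((Finset.univ.filter fun j => P (a j)).filter fun j => a j = b).card := by
        refine Finset.sum_le_sum fun b hb => ?_
        obtain ⟨i, hi, rfl⟩ := Finset.mem_image.mp hb
        refine (T.finrank_eigenspace_le _).trans ((hmult _).le.trans (Finset.card_le_card ?_))
        intro j hj
        have hj' : a j = a i := (Finset.mem_filter.mp hj).2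
        have hi' : P (a i) := (Finset.mem_filter.mp hi).2
        simp [hj', hi']
    _ = (Finset.univ.filter fun j => P (a j)).card :=
        (Finset.card_eq_sum_card_image a _).symm

/-- The vectors `(u, 0, B u)`, which form the kernel of the limiting system at `z = 0`. -/
noncomputable def slowLift {n : ℕ} (B : Fin n → ℝ) : (Fin n → ℂ) →ₗ[ℂ] Phase n where
  toFun u := Phase.mk u 0 ((fun i => (B i : ℂ)) ⬝ᵥ u)
  map_add' u v := by
    refine Phase.ext_components ?_ ?_ ?_
    · change _ = (Phase.mk _ _ _).u + (Phase.mk _ _ _).u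
      simp
    · change _ = (Phase.mk _ _ _).q + (Phase.mk _ _ _).q
      simp
    · change _ = (Phase.mk _ _ _).p + (Phase.mk _ _ _).p
      simp
  map_smul' c u := by
    refine Phase.ext_components ?_ ?_ ?_
    · change _ = c • (Phase.mk _ _ _).u
      simp
    · change _ = c • (Phase.mk _ _ _).q
      simp
    · change _ = c • (Phase.mk _ _ _).p
      simp

namespace RadiativeShock

variable {n : ℕ} {S : RadiativeShock n}

/-- The eigenvalue equation of the limiting system, with `q` and `B u` eliminated. -/
theorem specRhs_eq_smul_theta {L B : Fin n → ℝ} {A : Matrix (Fin n) (Fin n) ℝ} {z m : ℂ}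
    {W : Phase n} (h : specRhs L B z W = m • theta A W) :
    W.q = -(m * W.p) ∧ (fun i => (B i : ℂ)) ⬝ᵥ W.u = (1 - m ^ 2) * W.p ∧
      -(z • W.u) + (m ^ 2 * W.p) • (fun i => (L i : ℂ)) =
        m • (A.map Complex.ofReal *ᵥ W.u) := by
  have hp : -W.q = m * W.p := by
    have := congrArg Phase.p h
    rw [specRhs, Phase.p_mk] at this
    rw [this]
    change m * (Phase.mk _ _ _).p = _
    rw [Phase.p_mk]
  have hq : (fun i => (B i : ℂ)) ⬝ᵥ W.u - W.p = m * W.q := by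
    have := congrArg Phase.q h
    rw [specRhs, Phase.q_mk] at this
    rw [this]
    change m * (Phase.mk _ _ _).q = _
    rw [Phase.q_mk]
  have hu := congrArg Phase.u h
  have hu' : (m • theta A W).u = m • (A.map Complex.ofReal *ᵥ W.u) := by
    change m • (Phase.mk _ _ _).u = _
    rw [Phase.u_mk]
  rw [hu', specRhs, Phase.u_mk, map_ofReal_vecMulVec_mulVec] at hu
  have hB : (fun i => (B i : ℂ)) ⬝ᵥ W.u = (1 - m ^ 2) * W.p := by
    linear_combination hq - m * hp
  refine ⟨by rw [← hp, neg_neg], hB, ?_⟩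
  rw [← hu, hB]
  module

/-- An eigenvalue `μ = O(z)` of the limiting system satisfies `-u = μ'(0) A u`, so that `u` is an
eigenvector of `A` for `-1 / μ'(0)`. This number is real since `A` has real spectrum, and its sign
is dictated by the decay for `Re z > 0`. -/
theorem IsDecayingMode.exists_eigenvalue {σ : ℝ} {e : Fin n → ℝ} (he : e ∈ S.𝒰) {δ : ℝ}
    (hδ : 0 < δ) {φ : ℝ → ℂ → Phase n} {μ : ℂ → ℂ} {V : ℂ → Phase n}
    (h : S.IsDecayingMode σ e δ φ μ V) (hμ : μ 0 = 0) :
    V 0 = slowLift (grad S.g e) (V 0).u ∧ (V 0).u ≠ 0 ∧ ∃ a : ℝ, a ≠ 0 ∧ 0 ≤ σ * a ∧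
      (jac S.f e).map Complex.ofReal *ᵥ (V 0).u = (a : ℂ) • (V 0).u := by
  have h0 : (0 : ℂ) ∈ Metric.ball (0 : ℂ) δ := Metric.mem_ball_self hδ
  have hball : Metric.ball (0 : ℂ) δ ∈ 𝓝 0 := Metric.ball_mem_nhds _ hδ
  obtain ⟨hq0, hp0, -⟩ := specRhs_eq_smul_theta (h.eigen 0 h0)
  rw [hμ] at hq0 hp0
  have hlift : V 0 = slowLift (grad S.g e) (V 0).u := by
    refine Phase.ext_components ?_ ?_ ?_
    · simp [slowLift]
    · simp [slowLift, hq0]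
    · simp [slowLift, hp0]
  have hu0 : (V 0).u ≠ 0 := fun hu => h.V_ne 0 h0 (by rw [hlift, hu, map_zero])
  have hμd : HasDerivAt μ (deriv μ 0) 0 := (h.μ_holo.differentiableAt hball).hasDerivAt
  have hslope : Tendsto (fun z => z⁻¹ * μ z) (𝓝[≠] 0) (𝓝 (deriv μ 0)) := by
    refine (hasDerivAt_iff_tendsto_slope.mp hμd).congr fun z => ?_
    rw [slope_def_field, hμ, sub_zero, sub_zero, div_eq_inv_mul]
  have hVc : Tendsto V (𝓝[≠] 0) (𝓝 (V 0)) :=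
    (h.V_holo.continuousOn.continuousAt hball).tendsto.mono_left nhdsWithin_le_nhds
  have huc : Tendsto (fun z => (V z).u) (𝓝[≠] 0) (𝓝 (V 0).u) :=
    (Phase.continuous_u.tendsto _).comp hVc
  have hpc : Tendsto (fun z => (V z).p) (𝓝[≠] 0) (𝓝 (V 0).p) :=
    (Phase.continuous_p.tendsto _).comp hVc
  have hμc : Tendsto μ (𝓝[≠] 0) (𝓝 0) := by
    have := hμd.continuousAt.tendsto.mono_left (nhdsWithin_le_nhds (s := {0}ᶜ))
    rwa [hμ] at this
  have hAc : Continuous fun u : Fin n → ℂ => (jac S.f e).map Complex.ofReal *ᵥ u :=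
    continuous_const.matrix_mulVec continuous_id
  have hlim : -(V 0).u + (deriv μ 0 * 0 * (V 0).p) • (fun i => (S.L i : ℂ)) =
      deriv μ 0 • ((jac S.f e).map Complex.ofReal *ᵥ (V 0).u) := by
    refine tendsto_nhds_unique_of_eventuallyEq
      (huc.neg.add (((hslope.mul hμc).mul hpc).smul_const fun i => (S.L i : ℂ)))
      (hslope.smul ((hAc.tendsto _).comp huc)) ?_
    filter_upwards [self_mem_nhdsWithin, nhdsWithin_le_nhds hball] with z hz hzb
    have hz' : z ≠ 0 := hz
    have := congrArg (fun v => z⁻¹ • v) (specRhs_eq_smul_theta (h.eigen z hzb)).2.2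
    simp only [smul_add, smul_neg, smul_smul, inv_mul_cancel₀ hz', one_smul] at this
    rw [Function.comp_apply, ← this]
    congr 2
    ring
  rw [mul_zero, zero_mul, zero_smul, add_zero] at hlim
  have hκ : deriv μ 0 ≠ 0 := fun hκ => hu0 (by rw [hκ, zero_smul] at hlim; exact neg_eq_zero.mp hlim)
  have hAu : (jac S.f e).map Complex.ofReal *ᵥ (V 0).u = (-(deriv μ 0)⁻¹) • (V 0).u := by
    rw [neg_smul, ← smul_neg, hlim, smul_smul, inv_mul_cancel₀ hκ, one_smul]
  obtain ⟨a, ha⟩ : ∃ a : ℝ, (a : ℂ) = -(deriv μ 0)⁻¹ := by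
    have hev : Module.End.HasEigenvalue (Matrix.toLin' ((jac S.f e).map Complex.ofReal))
        (-(deriv μ 0)⁻¹) :=
      Module.End.hasEigenvalue_of_hasEigenvector
        (x := (V 0).u) ⟨Module.End.mem_eigenspace_iff.mpr (by rw [Matrix.toLin'_apply, hAu]), hu0⟩
    have hroot := (Module.End.hasEigenvalue_iff_isRoot_charpoly _ _).mp hev
    have h2 : ((jac S.f e).map Complex.ofReal).charpoly =
        (jac S.f e).charpoly.map Complex.ofRealHom := Matrix.charpoly_map _ Complex.ofRealHom
    rw [Matrix.charpoly_toLin', h2, S.a_charpoly e he, Polynomial.map_prod, Polynomial.IsRoot.def,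
      Polynomial.eval_prod, Finset.prod_eq_zero_iff] at hroot
    obtain ⟨j, -, hj⟩ := hroot
    have hj' : -(deriv μ 0)⁻¹ - (S.a j e : ℂ) = 0 := by
      simpa only [Polynomial.map_sub, Polynomial.map_X, Polynomial.map_C, Polynomial.eval_sub,
        Polynomial.eval_X, Polynomial.eval_C, Complex.ofRealHom_eq_coe] using hj
    exact ⟨S.a j e, (sub_eq_zero.mp hj').symm⟩
  have ha0 : a ≠ 0 := by
    rintro rfl
    rw [Complex.ofReal_zero, zero_eq_neg, inv_eq_zero] at ha
    exact hκ ha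
  refine ⟨hlift, hu0, a, ha0, ?_, by rw [hAu, ha]⟩
  have hκa : deriv μ 0 = ((-a⁻¹ : ℝ) : ℂ) := by
    push_cast
    rw [ha, inv_neg, inv_inv, neg_neg]
  -- `μ(t) / t → μ'(0)` along positive `t`, where `σ Re μ(t) < 0`
  have hsign : σ * (deriv μ 0).re ≤ 0 := by
    have hofReal : Tendsto (fun t : ℝ => (t : ℂ)) (𝓝[>] 0) (𝓝[≠] 0) := by
      refine tendsto_nhdsWithin_iff.mpr ⟨?_, ?_⟩
      · exact (Complex.continuous_ofReal.tendsto' 0 0 rfl).mono_left nhdsWithin_le_nhds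
      · filter_upwards [self_mem_nhdsWithin] with t ht
        exact Complex.ofReal_ne_zero.mpr (ne_of_gt ht)
    have hlim' := ((Complex.continuous_re.tendsto _).comp (hslope.comp hofReal)).const_mul σ
    refine le_of_tendsto hlim' ?_
    filter_upwards [self_mem_nhdsWithin, Ioo_mem_nhdsGT hδ] with t ht htδ
    have ht0 : (0 : ℝ) < t := ht
    have hdec := h.decay (t : ℂ) (by simpa [abs_of_pos ht0] using htδ.2) (by simpa using ht0)
    simp only [Function.comp_apply]
    rw [← Complex.ofReal_inv, Complex.re_ofReal_mul, mul_left_comm]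
    exact mul_nonpos_of_nonneg_of_nonpos (inv_nonneg.mpr ht0.le) hdec.le
  rw [hκa, Complex.ofReal_re, mul_neg, Left.neg_nonpos_iff] at hsign
  have : σ * a = (σ * a⁻¹) * a ^ 2 := by field_simp
  rw [this]
  exact mul_nonneg hsign (sq_nonneg a)

end RadiativeShock

namespace RadiativeShock

variable {n : ℕ} {S : RadiativeShock n}

/-- Slow modes span the sum of the eigenspaces on the decaying side: they are independent since the
vectors `V_c(0)` are determined by their `u`-components, and there are enough of them. -/
theorem slow_eigenvectors_span {σ : ℝ} (hσ : σ ≠ 0) {e : Fin n → ℝ} (he : e ∈ S.𝒰) {δ : ℝ}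
    (hδ : 0 < δ) (J : Finset (Fin (n + 2))) {φ : Fin (n + 2) → ℝ → ℂ → Phase n}
    {μ : Fin (n + 2) → ℂ → ℂ} {V : Fin (n + 2) → ℂ → Phase n}
    (h : ∀ c ∈ J, S.IsDecayingMode σ e δ (φ c) (μ c) (V c)) (hμ : ∀ c ∈ J, μ c 0 = 0)
    (hV : LinearIndependent ℂ fun c : J => V c 0)
    (hcard : J.card = (Finset.univ.filter fun j => 0 < σ * S.a j e).card) :
    (∀ c ∈ J, ∃ a : ℝ, 0 < σ * a ∧
      Module.End.HasEigenvector (Matrix.toLin' ((jac S.f e).map Complex.ofReal)) (a : ℂ)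
        ((jac S.f e).map Complex.ofReal *ᵥ (V c 0).u)) ∧
    Submodule.span ℂ ((fun c => (jac S.f e).map Complex.ofReal *ᵥ (V c 0).u) '' J) =
      ⨆ (a : ℝ) (_ : 0 < σ * a),
        Module.End.eigenspace (Matrix.toLin' ((jac S.f e).map Complex.ofReal)) (a : ℂ) := by
  have hex : ∀ c : J, ∃ a : ℝ, a ≠ 0 ∧ 0 < σ * a ∧
      (jac S.f e).map Complex.ofReal *ᵥ (V c 0).u = (a : ℂ) • (V c 0).u := by
    intro c
    obtain ⟨-, -, a, ha0, hσa, hAu⟩ := (h c c.2).exists_eigenvalue he hδ (hμ c c.2)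
    exact ⟨a, ha0, lt_of_le_of_ne hσa (mul_ne_zero hσ ha0).symm, hAu⟩
  choose a ha0 hσa hAu using hex
  have hmem : ∀ c : J, (jac S.f e).map Complex.ofReal *ᵥ (V c 0).u ∈
      Module.End.eigenspace (Matrix.toLin' ((jac S.f e).map Complex.ofReal)) (a c : ℂ) := by
    intro c
    rw [Module.End.mem_eigenspace_iff, Matrix.toLin'_apply, hAu, mulVec_smul, hAu]
  have hne : ∀ c : J, (a c : ℂ) ≠ 0 := fun c => Complex.ofReal_ne_zero.mpr (ha0 c)
  refine ⟨fun c hc => ⟨a ⟨c, hc⟩, hσa ⟨c, hc⟩, hmem ⟨c, hc⟩, ?_⟩, ?_⟩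
  · rw [hAu ⟨c, hc⟩]
    exact smul_ne_zero (hne _) ((h c hc).exists_eigenvalue he hδ (hμ c hc)).2.1
  · have hli : LinearIndependent ℂ fun c : J =>
        (jac S.f e).map Complex.ofReal *ᵥ (V c 0).u := by
      refine LinearIndependent.of_comp (slowLift (grad S.g e)) ?_
      convert! hV.units_smul fun c => Units.mk0 (a c : ℂ) (hne c) using 1
      ext1 c
      rw [Function.comp_apply, hAu, map_smul,
        ← ((h c c.2).exists_eigenvalue he hδ (hμ c c.2)).1]
      rfl
    rw [← span_range_eq_iSup_eigenspace (jac S.f e) (fun j => S.a j e) (S.a_charpoly e he)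
      (fun b => 0 < σ * b) _ hli (fun c => ⟨a c, hσa c, hmem c⟩) (by simpa using hcard)]
    congr 1
    ext v
    simp

/-! ### Limits and decay of the modes -/

variable {σ δ : ℝ} {e : Fin n → ℝ} {φ : ℝ → ℂ → Phase n} {μ : ℂ → ℂ} {V : ℂ → Phase n}

/-- Both ends are treated at once: `σ = 1` or `σ = -1`, and `σ * x` tends to the end of the mode as
`x → ∞`. -/
theorem IsDecayingMode.tendsto_slow (h : S.IsDecayingMode σ e δ φ μ V) (hδ : 0 < δ)
    (hσ : σ * σ = 1) (hμ : μ 0 = 0) : Tendsto (fun x => φ (σ * x) 0) atTop (𝓝 (V 0)) := by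
  obtain ⟨C, η, hη, hb⟩ := h.asymp
  have hexp : Tendsto (fun x : ℝ => C * Real.exp (-η * x)) atTop (𝓝 0) := by
    have : Tendsto (fun x : ℝ => Real.exp (-η * x)) atTop (𝓝 0) :=
      Real.tendsto_exp_atBot.comp (tendsto_id.const_mul_atTop_of_neg (neg_lt_zero.mpr hη))
    simpa using this.const_mul C
  have habs : |σ| = 1 := by nlinarith [abs_mul_abs_self σ, abs_nonneg σ]
  refine tendsto_iff_norm_sub_tendsto_zero.mpr (squeeze_zero' (Eventually.of_forall fun _ =>
    norm_nonneg _) ?_ hexp)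
  filter_upwards [eventually_ge_atTop 0] with x hx
  have := hb 0 (Metric.mem_ball_self hδ) (σ * x) (by rw [← mul_assoc, hσ, one_mul]; exact hx)
  simpa [hμ, abs_mul, habs, abs_of_nonneg hx] using this

/-- The flux of a slow mode at `z = 0` is constant, hence equal to its value `A u` at infinity. -/
theorem IsDecayingMode.consFlux_slow (h : S.IsDecayingMode σ e δ φ μ V) (he : e ∈ S.𝒰)
    (hδ : 0 < δ) (hσ : σ * σ = 1) (hμ : μ 0 = 0)
    (hU : Tendsto (fun x => S.U (σ * x)) atTop (𝓝 e)) (y : ℝ) :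
    consFlux (S.A y) S.L (φ y 0) = (jac S.f e).map Complex.ofReal *ᵥ (V 0).u := by
  have hd : ∀ x, HasDerivAt (fun t => consFlux (S.A t) S.L (φ t 0)) 0 x := fun x => by
    have := (h.sol 0 (Metric.mem_ball_self hδ)).hasDerivAt_consFlux (Set.mem_univ x)
    rwa [neg_zero, zero_smul] at this
  have hconst : ∀ x, consFlux (S.A x) S.L (φ x 0) = consFlux (S.A y) S.L (φ y 0) := fun x =>
    is_const_of_deriv_eq_zero (fun x => (hd x).differentiableAt) (fun x => (hd x).deriv) x y
  have hA : Tendsto (fun x => S.A (σ * x)) atTop (𝓝 (jac S.f e)) :=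
    (S.continuousOn_jac.continuousAt (S.isOpen_𝒰.mem_nhds he)).tendsto.comp hU
  have hlim := tendsto_consFlux hA (h.tendsto_slow hδ hσ hμ) S.L
  simp only [hconst] at hlim
  have hq : (V 0).q = 0 := by
    rw [(h.exists_eigenvalue he hδ hμ).1]; simp [slowLift]
  rw [tendsto_nhds_unique tendsto_const_nhds hlim, consFlux, hq, zero_smul, add_zero]

/-- A fast mode decays exponentially, uniformly for small spectral parameters. -/
theorem IsDecayingMode.exists_norm_le (h : S.IsDecayingMode σ e δ φ μ V) (hδ : 0 < δ)
    (hσ : σ * σ = 1) (hμ : σ * (μ 0).re < 0) :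
    ∃ r β C : ℝ, 0 < r ∧ r < δ ∧ 0 < β ∧ ∀ z ∈ Metric.closedBall (0 : ℂ) r, ∀ x, 0 ≤ x →
      ‖φ (σ * x) z‖ ≤ C * Real.exp (-β * x) := by
  obtain ⟨C, η, hη, hb⟩ := h.asymp
  have hball : Metric.ball (0 : ℂ) δ ∈ 𝓝 0 := Metric.ball_mem_nhds _ hδ
  have hμc : ContinuousAt (fun z => σ * (μ z).re) 0 :=
    (Complex.continuous_re.continuousAt.comp (h.μ_holo.continuousOn.continuousAt hball)).const_mul σ
  have hVc : ContinuousAt (fun z => ‖V z‖) 0 :=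
    (h.V_holo.continuousOn.continuousAt hball).norm
  have h1 : ∀ᶠ z in 𝓝 (0 : ℂ), σ * (μ z).re < σ * (μ 0).re / 2 :=
    hμc.eventually_lt_const (by linarith)
  have h2 : ∀ᶠ z in 𝓝 (0 : ℂ), ‖V z‖ < ‖V 0‖ + 1 := hVc.eventually_lt_const (by linarith)
  obtain ⟨r, hr, hrb⟩ := Metric.nhds_basis_closedBall.eventually_iff.mp
    ((h1.and h2).and (Metric.ball_mem_nhds (0 : ℂ) (half_pos hδ)))
  have hrδ : r < δ := by
    have := (@hrb (r : ℂ) (by simp [abs_of_pos hr])).2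
    have h3 : r < δ / 2 := by simpa [abs_of_pos hr] using this
    linarith
  refine ⟨r, -(σ * (μ 0).re / 2), ‖V 0‖ + 1 + |C|, hr, hrδ, by linarith, fun z hz x hx => ?_⟩
  obtain ⟨⟨hz1, hz2⟩, -⟩ := hrb hz
  have hzδ : z ∈ Metric.ball (0 : ℂ) δ := Metric.closedBall_subset_ball hrδ hz
  have hbz := hb z hzδ (σ * x) (by rw [← mul_assoc, hσ, one_mul]; exact hx)
  have hexp : ‖Complex.exp (μ z * ((σ * x : ℝ) : ℂ))‖ ≤
      Real.exp (-(-(σ * (μ 0).re / 2)) * x) := by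
    rw [Complex.norm_exp, Complex.re_mul_ofReal, Real.exp_le_exp]
    nlinarith
  -- the relative error in the asymptotics only needs to be bounded
  have hη1 : Real.exp (-η * |σ * x|) ≤ 1 := by
    rw [Real.exp_le_one_iff]
    nlinarith [abs_nonneg (σ * x)]
  set E := ‖Complex.exp (μ z * ((σ * x : ℝ) : ℂ))‖ with hE
  have hE0 : 0 ≤ E := norm_nonneg _
  calc ‖φ (σ * x) z‖ ≤ ‖Complex.exp (μ z * ((σ * x : ℝ) : ℂ)) • V z‖ +
        ‖φ (σ * x) z - Complex.exp (μ z * ((σ * x : ℝ) : ℂ)) • V z‖ :=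
        norm_le_insert' _ _
    _ ≤ E * (‖V 0‖ + 1) + |C| * E * 1 := by
        rw [norm_smul]
        refine add_le_add (by gcongr) (hbz.trans ?_)
        gcongr
        exact le_abs_self C
    _ = (‖V 0‖ + 1 + |C|) * E := by ring
    _ ≤ _ := by gcongr

/-- The derivative in `z` at `0` of the flux of a fast mode: as the flux satisfies `F' = -z u`, and
`u = U'` at `z = 0`, it is the integral of `U'` from `y` to the end state. -/
theorem IsDecayingMode.hasDerivAt_consFlux_fast (h : S.IsDecayingMode σ e δ φ μ V)
    (he : e ∈ S.𝒰) (hδ : 0 < δ) (hσ : σ * σ = 1) (hμ : σ * (μ 0).re < 0)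
    (hU : Tendsto (fun x => S.U (σ * x)) atTop (𝓝 e)) (hnorm : ∀ x, φ x 0 = S.profileDeriv x)
    (y : ℝ) :
    HasDerivAt (fun z => consFlux (S.A y) S.L (φ y z))
      ((fun i => (e i : ℂ)) - fun i => (S.U y i : ℂ)) 0 := by
  obtain ⟨r, β, C, hr, hrδ, hβ, hb⟩ := h.exists_norm_le hδ hσ hμ
  have habs : |σ| = 1 := by nlinarith [abs_mul_abs_self σ, abs_nonneg σ]
  have hsub : Metric.closedBall (0 : ℂ) r ⊆ Metric.ball 0 δ := Metric.closedBall_subset_ball hrδ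
  have hscale : ∀ x : ℝ, HasDerivAt (fun t => σ * t) σ x := fun x => by
    simpa using (hasDerivAt_id x).const_mul σ
  have hA : Tendsto (fun x => S.A (σ * x)) atTop (𝓝 (jac S.f e)) :=
    (S.continuousOn_jac.continuousAt (S.isOpen_𝒰.mem_nhds he)).tendsto.comp hU
  have key := hasDerivAt_param_of_hasDerivAt_of_decay
    (F := fun x z => consFlux (S.A (σ * x)) S.L (φ (σ * x) z))
    (v := fun x z => (σ : ℂ) • (φ (σ * x) z).u) (V := fun x i => (S.U (σ * x) i : ℂ))
    (e := fun i => (e i : ℂ)) (C := C) hr hβ ?_ ?_ ?_ ?_ ?_ ?_ (σ * y)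
  · simpa only [← mul_assoc, hσ, one_mul] using key
  · intro z hz x
    refine (((h.sol z (hsub hz)).hasDerivAt_consFlux (Set.mem_univ (σ * x))).scomp x
      (hscale x)).congr_deriv ?_
    ext i
    simp only [Pi.smul_apply, Complex.real_smul, smul_eq_mul]
    ring
  · have h1 : ContinuousOn (fun w : ℝ × ℂ => φ (σ * w.1) w.2)
        (Set.univ ×ˢ Metric.closedBall (0 : ℂ) r) :=
      h.cont.comp (f := fun w : ℝ × ℂ => (σ * w.1, w.2)) (by fun_prop)
        fun w hw => ⟨trivial, hsub hw.2⟩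
    exact (Phase.continuous_u.comp_continuousOn h1).const_smul (σ : ℂ)
  · intro z hz x hx
    rw [norm_smul, Complex.norm_real, Real.norm_eq_abs, habs, one_mul]
    exact (Phase.norm_u_le _).trans (hb z hz x hx)
  · intro z hz
    have hexp : Tendsto (fun x : ℝ => C * Real.exp (-β * x)) atTop (𝓝 0) := by
      have : Tendsto (fun x : ℝ => Real.exp (-β * x)) atTop (𝓝 0) :=
        Real.tendsto_exp_atBot.comp (tendsto_id.const_mul_atTop_of_neg (neg_lt_zero.mpr hβ))
      simpa using this.const_mul C
    have hφ : Tendsto (fun x => φ (σ * x) z) atTop (𝓝 0) := by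
      refine squeeze_zero_norm' ?_ hexp
      filter_upwards [eventually_ge_atTop 0] with x hx using hb z hz x hx
    simpa using tendsto_consFlux hA hφ S.L
  · intro x
    have h1 := (S.hasDerivAt_U (σ * x)).scomp x (hscale x)
    refine hasDerivAt_pi.mpr fun i => ?_
    refine ((hasDerivAt_pi.mp h1 i).ofReal_comp).congr_deriv ?_
    simp [hnorm, profileDeriv]
  · exact tendsto_pi_nhds.mpr fun i =>
      (Complex.continuous_ofReal.tendsto _).comp (hU.apply_nhds i)

end RadiativeShock

/-! ### The derivative of the Evans function at `z = 0` -/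

/-- Adding multiples of the row `q` to the rows of `A u` turns `A u` into the flux. -/
theorem det_consFlux_cols {n : ℕ} (A : Matrix (Fin n) (Fin n) ℝ) (L : Fin n → ℝ)
    (col : Fin (n + 2) → Phase n) :
    (Matrix.of fun i c => Phase.mk (consFlux A L (col c)) (col c).q (col c).p i).det =
      (A.det : ℂ) * (Matrix.of fun i c => col c i).det := by
  let T : Matrix (Fin n ⊕ Fin 2) (Fin n ⊕ Fin 2) ℂ :=
    fromBlocks (A.map Complex.ofReal) (Matrix.of fun i j => if j = 0 then (L i : ℂ) else 0) 0 1
  have hT : T.det = (A.det : ℂ) := by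
    rw [det_fromBlocks_zero₂₁, det_one, mul_one, RadiativeShock.det_map_ofReal]
  have hmul : (Matrix.of fun i c => Phase.mk (consFlux A L (col c)) (col c).q (col c).p i) =
      T.submatrix finSumFinEquiv.symm finSumFinEquiv.symm * Matrix.of fun i c => col c i := by
    ext i c
    rw [Matrix.mul_apply, Fin.sum_univ_add]
    induction i using Fin.addCases with
    | left i =>
      simp [T, Phase.mk, consFlux, mulVec, dotProduct, Phase.u, Phase.q, mul_comm]
    | right i =>
      match i with
      | 0 | 1 => simp [T, Phase.mk, Phase.q, Phase.p]
  rw [hmul, det_mul, det_submatrix_equiv_self, hT]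

theorem consFlux_sub {n : ℕ} (A : Matrix (Fin n) (Fin n) ℝ) (L : Fin n → ℝ) (W W' : Phase n) :
    consFlux A L (W - W') = consFlux A L W - consFlux A L W' := by
  have hu : (W - W').u = W.u - W'.u := rfl
  have hq : (W - W').q = W.q - W'.q := rfl
  rw [consFlux, consFlux, consFlux, hu, hq, mulVec_sub, sub_smul]
  abel

theorem hasDerivAt_phase_mk {n : ℕ} {u : ℂ → Fin n → ℂ} {q p : ℂ → ℂ} {u' : Fin n → ℂ}
    {q' p' z : ℂ} (hu : HasDerivAt u u' z) (hq : HasDerivAt q q' z) (hp : HasDerivAt p p' z) :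
    HasDerivAt (fun z => Phase.mk (u z) (q z) (p z)) (Phase.mk u' q' p') z := by
  refine hasDerivAt_pi.mpr fun i => ?_
  induction i using Fin.addCases with
  | left i => simpa [Phase.mk] using hasDerivAt_pi.mp hu i
  | right i =>
    match i with
    | 0 => simpa [Phase.mk] using hq
    | 1 => simpa [Phase.mk] using hp

namespace RadiativeShock

namespace EvansModes

variable {n : ℕ} {S : RadiativeShock n} (M : S.EvansModes)

/-- The columns of the matrix that defines the Evans function. -/
noncomputable def evansCol (w : ℝ → ℂ → Phase n) (y : ℝ) (z : ℂ) (c : Fin (n + 2)) : Phase n :=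
  if c.val < S.kp then M.φR c y z else if c.val = S.kp then w y z else M.φL c y z

theorem evansCol_last (w : ℝ → ℂ → Phase n) (y : ℝ) (z : ℂ) :
    M.evansCol w y z (Fin.last (n + 1)) = M.φL (Fin.last (n + 1)) y z := by
  have h : S.kp ≤ n := kp_le
  rw [evansCol, if_neg (by simp; omega), if_neg (by simp; omega)]

theorem evansCol_zero (w : ℝ → ℂ → Phase n) (y : ℝ) (z : ℂ) :
    M.evansCol w y z 0 = M.φR 0 y z := by
  rw [evansCol, if_pos (by simpa using kp_pos)]

/-- The columns of the Evans function, with the fast mode at `+∞` subtracted from the fast mode at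
`-∞`, so that the last column vanishes at `z = 0`. -/
noncomputable def reducedCol (w : ℝ → ℂ → Phase n) (y : ℝ) (z : ℂ) :
    Fin (n + 2) → Phase n :=
  Function.update (M.evansCol w y z) (Fin.last (n + 1))
    (M.φL (Fin.last (n + 1)) y z - M.φR 0 y z)

theorem evansDet_eq_det_reducedCol (w : ℝ → ℂ → Phase n) (y : ℝ) (z : ℂ) :
    M.evansDet w y z = (Matrix.of fun i c => M.reducedCol w y z c i).det := by
  have h0 : Fin.last (n + 1) ≠ (0 : Fin (n + 2)) := (Fin.last_pos).ne'
  have h1 : M.evansDet w y z = (Matrix.of fun i c => M.evansCol w y z c i).det := rfl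
  rw [h1, ← Matrix.det_updateCol_add_smul_self _ h0 (-1)]
  congr 1
  ext i c
  rcases eq_or_ne c (Fin.last (n + 1)) with rfl | hc
  · simp [reducedCol, evansCol_last, evansCol_zero, sub_eq_add_neg]
  · simp [reducedCol, hc]

theorem differentiableOn_evansCol {w : ℝ → ℂ → Phase n} {y : ℝ}
    (hw : DifferentiableOn ℂ (w y) (Metric.ball 0 M.δ)) (c : Fin (n + 2)) :
    DifferentiableOn ℂ (fun z => M.evansCol w y z c) (Metric.ball 0 M.δ) := by
  unfold evansCol
  split_ifs with h1 h2
  · exact (M.modeR c h1).holo y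
  · exact hw
  · exact (M.modeL c (by omega)).holo y

theorem continuousOn_evansCol {w : ℝ → ℂ → Phase n} {I : Set ℝ}
    (hw : ContinuousOn (fun x : ℝ × ℂ => w x.1 x.2) (I ×ˢ Metric.ball (0 : ℂ) M.δ))
    (c : Fin (n + 2)) :
    ContinuousOn (fun x : ℝ × ℂ => M.evansCol w x.1 x.2 c) (I ×ˢ Metric.ball (0 : ℂ) M.δ) := by
  unfold evansCol
  split_ifs with h1 h2
  · exact (M.modeR c h1).cont.mono (Set.prod_mono (Set.subset_univ _) le_rfl)
  · exact hw
  · exact (M.modeL c (by omega)).cont.mono (Set.prod_mono (Set.subset_univ _) le_rfl)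

theorem differentiableOn_evansDet {w : ℝ → ℂ → Phase n} {y : ℝ}
    (hw : DifferentiableOn ℂ (w y) (Metric.ball 0 M.δ)) :
    DifferentiableOn ℂ (M.evansDet w y) (Metric.ball 0 M.δ) := by
  have h : M.evansDet w y = fun z => (Matrix.of fun i c => M.evansCol w y z c i).det := rfl
  rw [h]
  simp only [Matrix.det_apply]
  refine DifferentiableOn.fun_sum fun σ _ => DifferentiableOn.const_smul ?_ _
  refine DifferentiableOn.fun_finsetProd fun i _ => ?_
  exact differentiableOn_pi.mp (M.differentiableOn_evansCol hw i) (σ i)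

theorem continuousOn_evansDet {w : ℝ → ℂ → Phase n} {I : Set ℝ}
    (hw : ContinuousOn (fun x : ℝ × ℂ => w x.1 x.2) (I ×ˢ Metric.ball (0 : ℂ) M.δ)) :
    ContinuousOn (fun x : ℝ × ℂ => M.evansDet w x.1 x.2) (I ×ˢ Metric.ball (0 : ℂ) M.δ) := by
  have h : (fun x : ℝ × ℂ => M.evansDet w x.1 x.2) =
      fun x => (Matrix.of fun i c => M.evansCol w x.1 x.2 c i).det := rfl
  rw [h]
  simp only [Matrix.det_apply]
  refine continuousOn_finsetSum _ fun σ _ => ContinuousOn.const_smul ?_ _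
  refine continuousOn_finsetProd _ fun i _ => ?_
  exact continuousOn_pi.mp (M.continuousOn_evansCol hw i) (σ i)

theorem evansDet_zero (w : ℝ → ℂ → Phase n) (y : ℝ) : M.evansDet w y 0 = 0 := by
  rw [evansDet_eq_det_reducedCol]
  refine Matrix.det_eq_zero_of_column_eq_zero (Fin.last (n + 1)) fun i => ?_
  simp [reducedCol, M.normR, M.normL]

theorem tendsto_U_neg : Tendsto (fun x => S.U (-1 * x)) atTop (𝓝 S.uL) := by
  simpa only [neg_one_mul, Function.comp_def] using S.U_atBot.comp tendsto_neg_atTop_atBot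

theorem consFlux_φR {c : Fin (n + 2)} (h1 : 1 ≤ c.val) (hc : c.val < S.kp) (y : ℝ) :
    consFlux (S.A y) S.L (M.φR c y 0) = M.rR c :=
  (M.modeR c hc).consFlux_slow S.uR_mem M.δ_pos (by norm_num) (M.slowR c h1 hc)
    (by simpa using S.U_atTop) y

theorem consFlux_φL {c : Fin (n + 2)} (hc : S.kp < c.val) (h1 : c.val < n + 1) (y : ℝ) :
    consFlux (S.A y) S.L (M.φL c y 0) = M.rL c :=
  (M.modeL c hc).consFlux_slow S.uL_mem M.δ_pos (by norm_num) (M.slowL c hc h1)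
    tendsto_U_neg y

/-- The flux of the difference of the fast modes has derivative `-[u]` at `z = 0`. -/
theorem hasDerivAt_consFlux_sub (y : ℝ) :
    HasDerivAt (fun z => consFlux (S.A y) S.L (M.φL (Fin.last (n + 1)) y z - M.φR 0 y z))
      (fun i => -((S.uR i - S.uL i : ℝ) : ℂ)) 0 := by
  have hL := M.fastModeL.hasDerivAt_consFlux_fast S.uL_mem M.δ_pos (by norm_num)
    (by linarith [M.fastL]) tendsto_U_neg M.normL y
  have hR := M.fastMode.hasDerivAt_consFlux_fast S.uR_mem M.δ_pos (by norm_num)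
    (by linarith [M.fastR]) (by simpa using S.U_atTop) M.normR y
  simp only [consFlux_sub]
  refine (hL.sub hR).congr_deriv ?_
  ext i
  simp

/-- The first order coefficient of the Evans function, for a mode `w` with vanishing flux at
`z = 0`. -/
theorem hasDerivAt_evansDet {w : ℝ → ℂ → Phase n} {y : ℝ} (hy : y ≠ 0)
    (hw : DifferentiableOn ℂ (w y) (Metric.ball 0 M.δ))
    (hw0 : consFlux (S.A y) S.L (w y 0) = 0) :
    HasDerivAt (M.evansDet w y)
      ((-1) ^ (S.kp + 1) * ((S.A y).det : ℂ)⁻¹ * M.gammaDet w y * M.lopatinski) 0 := by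
  have hkpos : 0 < S.kp := kp_pos
  have hkn : S.kp ≤ n := kp_le
  have hball : Metric.ball (0 : ℂ) M.δ ∈ 𝓝 0 := Metric.ball_mem_nhds _ M.δ_pos
  let N : ℂ → Matrix (Fin (n + 2)) (Fin (n + 2)) ℂ := fun z => Matrix.of fun i c =>
    Phase.mk (consFlux (S.A y) S.L (M.reducedCol w y z c)) (M.reducedCol w y z c).q
      (M.reducedCol w y z c).p i
  have hA : ((S.A y).det : ℂ) ≠ 0 := Complex.ofReal_ne_zero.mpr (S.det_A_ne_zero hy)
  have hdetN : ∀ z, M.evansDet w y z = ((S.A y).det : ℂ)⁻¹ * (N z).det := fun z => by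
    rw [det_consFlux_cols, ← evansDet_eq_det_reducedCol, inv_mul_cancel_left₀ hA]
  have hcol : ∀ c, DifferentiableAt ℂ (fun z => M.reducedCol w y z c) 0 := by
    intro c
    rcases eq_or_ne c (Fin.last (n + 1)) with rfl | hc
    · simp only [reducedCol, Function.update_self]
      exact ((M.fastModeL.holo y).differentiableAt hball).sub
        ((M.fastMode.holo y).differentiableAt hball)
    · simp only [reducedCol, Function.update_of_ne hc]
      exact (M.differentiableOn_evansCol hw c).differentiableAt hball
  have hNcont : ContinuousAt N 0 := by
    refine continuousAt_pi.mpr fun i => continuousAt_pi.mpr fun c => ?_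
    have h1 : Tendsto (fun z => M.reducedCol w y z c) (𝓝 0) (𝓝 (M.reducedCol w y 0 c)) :=
      (hcol c).continuousAt
    induction i using Fin.addCases with
    | left i =>
      have := (tendsto_consFlux (tendsto_const_nhds (x := S.A y)) h1 S.L).apply_nhds i
      simpa [N, Phase.mk, ContinuousAt] using this
    | right i =>
      match i with
      | 0 => simpa [N, Phase.mk, Phase.q, ContinuousAt] using h1.apply_nhds (Fin.natAdd n 0)
      | 1 => simpa [N, Phase.mk, Phase.p, ContinuousAt] using h1.apply_nhds (Fin.natAdd n 1)
  obtain ⟨dq, hdq⟩ : ∃ d, HasDerivAt (fun z => (M.reducedCol w y z (Fin.last (n + 1))).q) d 0 :=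
    ⟨_, (differentiableAt_pi.mp (hcol _) (Fin.natAdd n 0)).hasDerivAt⟩
  obtain ⟨dp, hdp⟩ : ∃ d, HasDerivAt (fun z => (M.reducedCol w y z (Fin.last (n + 1))).p) d 0 :=
    ⟨_, (differentiableAt_pi.mp (hcol _) (Fin.natAdd n 1)).hasDerivAt⟩
  have hflux : HasDerivAt
      (fun z => consFlux (S.A y) S.L (M.reducedCol w y z (Fin.last (n + 1))))
      (fun i => -((S.uR i - S.uL i : ℝ) : ℂ)) 0 := by
    simpa only [reducedCol, Function.update_self] using M.hasDerivAt_consFlux_sub y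
  have hlast0 : M.reducedCol w y 0 (Fin.last (n + 1)) = 0 := by
    simp [reducedCol, M.normR, M.normL]
  have hN0 : ∀ i, N 0 i (Fin.last (n + 1)) = 0 := by
    intro i
    simp only [N, Matrix.of_apply, hlast0, consFlux_zero, Phase.q_zero, Phase.p_zero]
    have : Phase.mk (0 : Fin n → ℂ) 0 0 = 0 := Phase.ext_components (by simp) (by simp) (by simp)
    rw [this]; rfl
  have hder := Matrix.hasDerivAt_det_of_col_eq_zero hNcont hN0
    (fun i => hasDerivAt_pi.mp (hasDerivAt_phase_mk hflux hdq hdp) i)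
  have hfun : M.evansDet w y = fun z => ((S.A y).det : ℂ)⁻¹ * (N z).det := funext hdetN
  rw [hfun]
  refine (hder.const_mul _).congr_deriv ?_
  -- column `k + 1 = kp` holds the singular mode
  obtain ⟨k, hk⟩ : ∃ k : Fin (n + 1), k.val + 1 = S.kp := ⟨⟨S.kp - 1, by omega⟩, by simp; omega⟩
  set N' := (N 0).updateCol (Fin.last (n + 1))
    (Phase.mk (fun i => -((S.uR i - S.uL i : ℝ) : ℂ)) dq dp) with hN'
  have hN'ne : ∀ i c, c ≠ Fin.last (n + 1) → N' i c =
      Phase.mk (consFlux (S.A y) S.L (M.evansCol w y 0 c)) (M.evansCol w y 0 c).q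
        (M.evansCol w y 0 c).p i := by
    intro i c hc
    rw [hN', Matrix.updateCol_ne hc]
    simp [N, reducedCol, hc]
  have h0last : (0 : Fin (n + 2)) ≠ Fin.last (n + 1) := (Fin.last_pos).ne
  have hklast : k.succ ≠ Fin.last (n + 1) := by
    intro h
    have := congrArg Fin.val h
    simp at this
    omega
  have hcol0 : M.evansCol w y 0 0 = M.φR 0 y 0 := M.evansCol_zero w y 0
  have hcolk : M.evansCol w y 0 k.succ = w y 0 := by
    rw [evansCol, if_neg (by simp; omega), if_pos (by simp; omega)]
  have hN'q : ∀ c, c ≠ Fin.last (n + 1) → N' (Fin.natAdd n 0) c = (M.evansCol w y 0 c).q :=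
    fun c hc => by rw [hN'ne _ _ hc]; simp [Phase.mk]
  have hN'p : ∀ c, c ≠ Fin.last (n + 1) → N' (Fin.natAdd n 1) c = (M.evansCol w y 0 c).p :=
    fun c hc => by rw [hN'ne _ _ hc]; simp [Phase.mk]
  have hN'u : ∀ i c, c ≠ Fin.last (n + 1) → N' (Fin.castAdd 2 i) c =
      consFlux (S.A y) S.L (M.evansCol w y 0 c) i :=
    fun i c hc => by rw [hN'ne _ _ hc]; simp [Phase.mk]
  have hminor : (Matrix.of fun i c : Fin n => N' (Fin.castAdd 2 i) (k.succ.succAbove c.succ)).det =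
      M.lopatinski := by
    rw [lopatinski]
    congr 1
    ext i c
    simp only [Matrix.of_apply]
    split_ifs with h1 h2
    · have hc : k.succ.succAbove c.succ = c.castSucc.succ := by
        rw [Fin.succAbove_of_castSucc_lt _ _ (by simp [Fin.lt_def]; omega), Fin.succ_castSucc]
      rw [hc, hN'u _ _ (by simp [Fin.ext_iff]; omega), evansCol, if_pos (by simpa using h1),
        M.consFlux_φR (by simp) (by simpa using h1)]
    · have hc : k.succ.succAbove c.succ = c.succ.succ :=
        Fin.succAbove_of_le_castSucc _ _ (by simp [Fin.le_def]; omega)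
      rw [hc, hN'u _ _ (by simp [Fin.ext_iff]; omega), evansCol, if_neg (by simp; omega),
        if_neg (by simp; omega), M.consFlux_φL (by simp; omega) (by simp; omega)]
    · have hc : k.succ.succAbove c.succ = Fin.last (n + 1) := by
        rw [Fin.succAbove_of_le_castSucc _ _ (by simp [Fin.le_def]; omega)]
        ext
        simp
        omega
      rw [hc, hN', Matrix.updateCol_self]
      simp [Phase.mk]
  rw [Matrix.det_eq_of_two_cols N' k
    (fun i => by rw [hN'u _ _ h0last, hcol0, M.normR, S.consFlux_profileDeriv]; rfl)
    (fun i => by rw [hN'u _ _ hklast, hcolk, hw0]; rfl), hminor, hN'q _ h0last, hN'q _ hklast,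
    hN'p _ h0last, hN'p _ hklast, hcol0, hcolk, gammaDet, ← hk]
  ring

/-- The expansion of `D(y, z)` on one side of the sonic point, locally uniformly in `y`. -/
theorem exists_evansDet_expansion {I : Set ℝ} (hIo : IsOpen I) (hI : I.OrdConnected) (hI0 : 0 ∉ I)
    [NeBot (𝓝[I] (0 : ℝ))] {w : ℝ → ℂ → Phase n} (hw : S.IsSingularMode I M.δ w) {ε : ℝ}
    (hε : 0 < ε) (hεδ : 2 * ε < M.δ) {K : Set ℝ} (hK : IsCompact K) (hKI : K ⊆ I) :
    ∃ C : ℝ, ∀ y ∈ K, ∀ z : ℂ, ‖z‖ ≤ ε →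
      ‖M.evansDet w y z - (-1) ^ (S.kp + 1) * ((S.A y).det : ℂ)⁻¹ * M.gammaDet w y *
        M.lopatinski * z‖ ≤ C * ‖z‖ ^ 2 :=
  exists_forall_norm_sub_mul_le_sq hε hεδ hK
    (M.continuousOn_evansDet (hw.cont.mono (Set.prod_mono hKI le_rfl)))
    (fun y hy => M.differentiableOn_evansDet (hw.holo y (hKI hy)))
    (fun y _ => M.evansDet_zero w y)
    (fun y hy => M.hasDerivAt_evansDet (fun h => hI0 (h ▸ hKI hy)) (hw.holo y (hKI hy))
      (hw.consFlux_eq_zero hIo hI M.δ_pos (hKI hy)))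

end EvansModes

end RadiativeShock

/-! ### Spans of the slow eigenvectors and the final comparison -/

namespace RadiativeShock

namespace EvansModes

variable {n : ℕ} {S : RadiativeShock n} (M : S.EvansModes)

theorem eigenvectors_span_R :
    (∀ c : Fin (n + 2), 1 ≤ c.val → c.val < S.kp → ∃ a : ℝ, 0 < a ∧
        Module.End.HasEigenvector
          (Matrix.toLin' ((jac S.f S.uR).map Complex.ofReal)) (a : ℂ) (M.rR c)) ∧
      Submodule.span ℂ (M.rR '' {c | 1 ≤ c.val ∧ c.val < S.kp}) =
        ⨆ (a : ℝ) (_ : 0 < a), Module.End.eigenspace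
          (Matrix.toLin' ((jac S.f S.uR).map Complex.ofReal)) (a : ℂ) := by
  have hkpos : 0 < S.kp := kp_pos
  have hkn : S.kp ≤ n := kp_le
  let J : Finset (Fin (n + 2)) := Finset.univ.filter fun c => 1 ≤ c.val ∧ c.val < S.kp
  have hJ : ∀ c, c ∈ J ↔ 1 ≤ c.val ∧ c.val < S.kp := fun c => by simp [J]
  have hli : LinearIndependent ℂ fun c : J => M.VR c 0 :=
    M.indepR.comp (fun c : J => ⟨c.1, ((hJ _).mp c.2).2⟩) fun c d h =>
      Subtype.ext (Subtype.mk.inj h)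
  have hcard : J.card = (Finset.univ.filter fun j => 0 < (1 : ℝ) * S.a j S.uR).card := by
    have h1 : J = Finset.Ico ⟨1, by omega⟩ ⟨S.kp, by omega⟩ := by
      ext c; simp [hJ, Fin.le_def, Fin.lt_def]
    have h2 : (Finset.univ.filter fun j => 0 < (1 : ℝ) * S.a j S.uR) = Finset.Ioi S.p := by
      ext j
      rw [Finset.mem_filter, Finset.mem_Ioi, one_mul]
      refine ⟨fun h => ?_, fun h => ⟨Finset.mem_univ _, S.lax_R.2 j h⟩⟩
      by_contra! hj
      exact absurd (h.2.trans_le (S.a_mono _ S.uR_mem hj)) (not_lt.mpr S.lax_R.1.le)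
    rw [h1, h2, Fin.card_Ico, Fin.card_Ioi]
    simp only [kp]
    omega
  obtain ⟨h1, h2⟩ := slow_eigenvectors_span one_ne_zero S.uR_mem M.δ_pos J
    (fun c hc => M.modeR c ((hJ c).mp hc).2)
    (fun c hc => M.slowR c ((hJ c).mp hc).1 ((hJ c).mp hc).2) hli hcard
  simp only [one_mul] at h1 h2
  refine ⟨fun c hc hc' => h1 c ((hJ c).mpr ⟨hc, hc'⟩), ?_⟩
  rw [← h2]
  congr 2
  ext c
  simp [hJ]

theorem eigenvectors_span_L :
    (∀ c : Fin (n + 2), S.kp < c.val → c.val < n + 1 → ∃ a : ℝ, a < 0 ∧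
        Module.End.HasEigenvector
          (Matrix.toLin' ((jac S.f S.uL).map Complex.ofReal)) (a : ℂ) (M.rL c)) ∧
      Submodule.span ℂ (M.rL '' {c | S.kp < c.val ∧ c.val < n + 1}) =
        ⨆ (a : ℝ) (_ : a < 0), Module.End.eigenspace
          (Matrix.toLin' ((jac S.f S.uL).map Complex.ofReal)) (a : ℂ) := by
  have hkpos : 0 < S.kp := kp_pos
  have hkn : S.kp ≤ n := kp_le
  let J : Finset (Fin (n + 2)) := Finset.univ.filter fun c => S.kp < c.val ∧ c.val < n + 1
  have hJ : ∀ c, c ∈ J ↔ S.kp < c.val ∧ c.val < n + 1 := fun c => by simp [J]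
  have hli : LinearIndependent ℂ fun c : J => M.VL c 0 :=
    M.indepL.comp (fun c : J => ⟨c.1, ((hJ _).mp c.2).1⟩) fun c d h =>
      Subtype.ext (Subtype.mk.inj h)
  have hcard : J.card = (Finset.univ.filter fun j => 0 < (-1 : ℝ) * S.a j S.uL).card := by
    have h1 : J = Finset.Ioo ⟨S.kp, by omega⟩ (Fin.last (n + 1)) := by
      ext c; simp [hJ, Fin.lt_def]
    have h2 : (Finset.univ.filter fun j => 0 < (-1 : ℝ) * S.a j S.uL) = Finset.Iio S.p := by
      ext j
      rw [Finset.mem_filter, Finset.mem_Iio, neg_one_mul, neg_pos]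
      refine ⟨fun h => ?_, fun h => ⟨Finset.mem_univ _, S.lax_L.1 j h⟩⟩
      by_contra! hj
      exact absurd ((S.a_mono _ S.uL_mem hj).trans_lt h.2) (not_lt.mpr S.lax_L.2.le)
    have := S.p.isLt
    rw [h1, h2, Fin.card_Ioo, Fin.card_Iio]
    simp only [kp, Fin.val_last]
    omega
  obtain ⟨h1, h2⟩ := slow_eigenvectors_span (neg_ne_zero.mpr one_ne_zero) S.uL_mem M.δ_pos J
    (fun c hc => M.modeL c ((hJ c).mp hc).1)
    (fun c hc => M.slowL c ((hJ c).mp hc).1 ((hJ c).mp hc).2) hli hcard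
  simp only [neg_one_mul, neg_pos] at h1 h2
  refine ⟨fun c hc hc' => h1 c ((hJ c).mpr ⟨hc, hc'⟩), ?_⟩
  rw [← h2]
  congr 2
  ext c
  simp [hJ]

end EvansModes

end RadiativeShock

theorem lemma2p5 {n : ℕ} (S : RadiativeShock n) (M : S.EvansModes) :
    -- the vectors `r_j⁺`, `r_j⁻` are eigenvectors of `A₊`, `A₋` for positive, resp. negative,
    -- eigenvalues, and span the corresponding invariant subspaces
    ((∀ c : Fin (n + 2), 1 ≤ c.val → c.val < S.kp → ∃ a : ℝ, 0 < a ∧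
        Module.End.HasEigenvector
          (Matrix.toLin' ((jac S.f S.uR).map Complex.ofReal)) (a : ℂ) (M.rR c)) ∧
      Submodule.span ℂ (M.rR '' {c | 1 ≤ c.val ∧ c.val < S.kp}) =
        ⨆ (a : ℝ) (_ : 0 < a), Module.End.eigenspace
          (Matrix.toLin' ((jac S.f S.uR).map Complex.ofReal)) (a : ℂ)) ∧
    ((∀ c : Fin (n + 2), S.kp < c.val → c.val < n + 1 → ∃ a : ℝ, a < 0 ∧
        Module.End.HasEigenvector
          (Matrix.toLin' ((jac S.f S.uL).map Complex.ofReal)) (a : ℂ) (M.rL c)) ∧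
      Submodule.span ℂ (M.rL '' {c | S.kp < c.val ∧ c.val < n + 1}) =
        ⨆ (a : ℝ) (_ : a < 0), Module.End.eigenspace
          (Matrix.toLin' ((jac S.f S.uL).map Complex.ofReal)) (a : ℂ)) ∧
    -- expansion of the two Evans functions, locally uniformly in `y`
    (∃ ε : ℝ, 0 < ε ∧
      (∀ K : Set ℝ, IsCompact K → K ⊆ Set.Ioi 0 → ∃ C : ℝ, ∀ y ∈ K, ∀ z : ℂ, ‖z‖ ≤ ε →
        ‖M.DPos y z - (-1) ^ (S.kp + 1) * ((S.A y).det : ℂ)⁻¹ * M.gammaPos y *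
          M.lopatinski * z‖ ≤ C * ‖z‖ ^ 2) ∧
      (∀ K : Set ℝ, IsCompact K → K ⊆ Set.Iio 0 → ∃ C : ℝ, ∀ y ∈ K, ∀ z : ℂ, ‖z‖ ≤ ε →
        ‖M.DNeg y z - (-1) ^ (S.kp + 1) * ((S.A y).det : ℂ)⁻¹ * M.gammaNeg y *
          M.lopatinski * z‖ ≤ C * ‖z‖ ^ 2)) ∧
    -- comparison of `D₊(z) = D₊(1, z)` and `D₋(z) = D₋(-1, z)`
    (∃ m : ℂ, m ≠ 0 ∧ ∃ ε : ℝ, 0 < ε ∧ ∃ C : ℝ, ∀ z : ℂ, ‖z‖ ≤ ε →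
      ‖M.DPos 1 z - m * M.DNeg (-1) z‖ ≤ C * ‖z‖ ^ 2) := by
  have hε : 0 < M.δ / 4 := by linarith [M.δ_pos]
  have hεδ : 2 * (M.δ / 4) < M.δ := by linarith [M.δ_pos]
  have hpos := fun (K : Set ℝ) (hK : IsCompact K) (hKI : K ⊆ Set.Ioi 0) =>
    M.exists_evansDet_expansion isOpen_Ioi Set.ordConnected_Ioi (by simp) M.modePos hε hεδ hK hKI
  have hneg := fun (K : Set ℝ) (hK : IsCompact K) (hKI : K ⊆ Set.Iio 0) =>
    M.exists_evansDet_expansion isOpen_Iio Set.ordConnected_Iio (by simp) M.modeNeg hε hεδ hK hKI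
  refine ⟨M.eigenvectors_span_R, M.eigenvectors_span_L, ⟨M.δ / 4, hε, hpos, hneg⟩, ?_⟩
  obtain ⟨C₁, hC₁⟩ := hpos {1} isCompact_singleton (by simp)
  obtain ⟨C₂, hC₂⟩ := hneg {-1} isCompact_singleton (by simp)
  have hγ₁ : M.gammaDet M.wPos 1 ≠ 0 := M.gammaDet_ne_zero isOpen_Ioi Set.ordConnected_Ioi
    (by simp) M.modePos (by simp)
  have hγ₂ : M.gammaDet M.wNeg (-1) ≠ 0 := M.gammaDet_ne_zero isOpen_Iio Set.ordConnected_Iio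
    (by simp) M.modeNeg (by simp)
  have hA₁ : ((S.A 1).det : ℂ) ≠ 0 :=
    Complex.ofReal_ne_zero.mpr (S.det_A_ne_zero one_ne_zero)
  have hA₂ : ((S.A (-1)).det : ℂ) ≠ 0 :=
    Complex.ofReal_ne_zero.mpr (S.det_A_ne_zero (neg_ne_zero.mpr one_ne_zero))
  -- the quotient of the two first order coefficients, with the common factor `Δ` removed
  let m : ℂ := (((S.A 1).det : ℂ)⁻¹ * M.gammaDet M.wPos 1) /
    (((S.A (-1)).det : ℂ)⁻¹ * M.gammaDet M.wNeg (-1))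
  have hm : m * (((S.A (-1)).det : ℂ)⁻¹ * M.gammaDet M.wNeg (-1)) =
      ((S.A 1).det : ℂ)⁻¹ * M.gammaDet M.wPos 1 :=
    div_mul_cancel₀ _ (mul_ne_zero (inv_ne_zero hA₂) hγ₂)
  refine ⟨m, div_ne_zero (mul_ne_zero (inv_ne_zero hA₁) hγ₁)
    (mul_ne_zero (inv_ne_zero hA₂) hγ₂), M.δ / 4, hε, C₁ + ‖m‖ * C₂, fun z hz => ?_⟩
  have h₁ := hC₁ 1 rfl z hz
  have h₂ := hC₂ (-1) rfl z hz
  set E₁ := M.evansDet M.wPos 1 z - (-1) ^ (S.kp + 1) * ((S.A 1).det : ℂ)⁻¹ *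
    M.gammaDet M.wPos 1 * M.lopatinski * z with hE₁
  set E₂ := M.evansDet M.wNeg (-1) z - (-1) ^ (S.kp + 1) * ((S.A (-1)).det : ℂ)⁻¹ *
    M.gammaDet M.wNeg (-1) * M.lopatinski * z with hE₂
  have hsplit : M.DPos 1 z - m * M.DNeg (-1) z = E₁ - m * E₂ := by
    rw [hE₁, hE₂, RadiativeShock.EvansModes.DPos, RadiativeShock.EvansModes.DNeg]
    linear_combination (-(-1) ^ (S.kp + 1) * M.lopatinski * z) * hm
  calc ‖M.DPos 1 z - m * M.DNeg (-1) z‖ ≤ ‖E₁‖ + ‖m‖ * ‖E₂‖ := by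
        rw [hsplit, ← norm_mul]; exact norm_sub_le _ _
    _ ≤ C₁ * ‖z‖ ^ 2 + ‖m‖ * (C₂ * ‖z‖ ^ 2) := by gcongr
    _ = (C₁ + ‖m‖ * C₂) * ‖z‖ ^ 2 := by ring
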